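/- Let $X$ be a closed (compact, connected) Riemann surface and $L\to X$ a holomorphic line bundle. An $L$-twisted $\operatorname{GL}(n,\mathbb R)$-Higgs pair $((W,Q),\psi)$ consists of a holomorphic vector bundle $W\to X$ of rank $n$, a holomorphic non-degenerate quadratic form $Q$ on $W$, and a section $\psi\in H^0(X,L\otimes S^2W)$. For subbundles $A,B\subset W$ let $A\otimes_S B\subset S^2W$ be the image of $A\otimes B$. Consider filtrations by holomorphic subbundles $\mathcal W=(0=W_0\subsetneq W_1\subsetneq\dots\subsetneq W_k=W)$ with $W_j=W_{k-j}^{\perp_Q}$ for all $j$, and the set $\Lambda(\mathcal W)$ of $\lambda\in\mathbb R^k$ with $\lambda_i\le\lambda_{i+1}$ and $\lambda_i+\lambda_{k-i+1}=0$ for all $i$. Put $$N(\mathcal W,\lambda)=\sum_{\lambda_i+\lambda_j\le 0}L\otimes W_i\otimes_S W_j,\qquad d(\mathcal W,\lambda)=\sum_{j=1}^{k-1}(\lambda_j-\lambda_{j+1})\deg W_j .$$ The pair is *semistable* if $d(\mathcal W,\lambda)\ge 0$ for all $\mathcal W$ and all $\lambda\in\Lambda(\mathcal W)$ with $\psi\in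 H^0(N(\mathcal W,\lambda))$. It is *stable* if it is semistable and $d(\mathcal W,\lambda)>0$ whenever moreover $\lambda\ne 0$. It is *polystable* if it is semistable and for all $\mathcal W$ and $\lambda\in\Lambda(\mathcal W)$ with $\lambda_i<\lambda_{i+1}$ for all $i$, $\psi\in H^0(N(\mathcal W,\lambda))$ and $d(\mathcal W,\lambda)=0$, there is a holomorphic splitting of the filtration, $W\simeq\bigoplus_{i=1}^k W_i/W_{i-1}$, under which $Q$ pairs the $i$-th and $j$-th summands to zero unless $i+j=k+1$, and $\psi\in H^0\big(\bigoplus_{\lambda_i+\lambda_j=0}L\otimes (W_i/W_{i-1})\otimes_S(W_j/W_{j-1})\big)$. Call a holomorphic subbundle $W'\subset W$ *admissible* if it is isotropic for $Q$ and $\psi\in H^0\big(L\otimes(S^2W'^{\perp_Q}+W'\otimes_S W)\big)$. **Theorem.** Let $((W,Q),\psi)$ be an $L$-twisted $\operatorname{GL}(n,\mathbb R)$-Higgs pair. 1. It is semistable if and only if $\deg W'\le 0$ for every admissible $W'\subset W$. 2. It is stable if and only if it is semistable and $\deg W'<0$ for every admissible $W'$ with $0\ne W'\subsetneq W$. 3.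 It is polystable if it is semistable and for every admissible $W'$ with $0\neq W'\subsetneq W$ and $\deg W'=0$ there is an admissible $W''$ with $W=W'\oplus W''$. 4. It is polystable if and only if it is semistable and for every admissible $W'$ with $0\neq W'\subsetneq W$ and $\deg W'=0$ there is an admissible $W''$ with $W=W'^{\perp_Q}\oplus W''$. -/

import Mathlib

open Bundle Set Topology Manifold TensorProduct
open scoped ContDiff

noncomputable section

namespace HiggsPair

/-! ### Riemann surfaces and holomorphic vector bundles

A closed Riemann surface is a compact connected Hausdorff space `X` charted on `ℂ` with holomorphic
transition maps.  A holomorphic vector bundle on `X` with model fibre `F` (of rank `dim F`) is a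
family `W : X → Type*` with Mathlib's classes `FiberBundle`, `VectorBundle` and
`ContMDiffVectorBundle ω`. -/

section RealStructure

variable (X : Type*) [TopologicalSpace X] [ChartedSpace ℂ X]

/-- The smooth real manifold that underlies a Riemann surface. -/
theorem isManifold_real [IsManifold 𝓘(ℂ) ω X] : IsManifold 𝓘(ℝ, ℂ) ∞ X := by
  refine isManifold_of_contDiffOn 𝓘(ℝ, ℂ) ∞ X fun e e' he he' => ?_
  have h := (StructureGroupoid.compatible (contDiffGroupoid ω 𝓘(ℂ)) he he').1
  have h' : ContDiffOn ℂ ω (e.symm ≫ₕ e') (e.symm ≫ₕ e').source := by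
    simpa [contDiffPregroupoid] using h
  simpa using (h'.restrict_scalars ℝ).of_le le_top

variable {X} in
theorem contMDiffAt_real {f : X → ℂ} {x : X} (hf : ContMDiffAt 𝓘(ℂ) 𝓘(ℂ) ω f x) :
    ContMDiffAt 𝓘(ℝ, ℂ) 𝓘(ℝ, ℂ) ∞ f x := by
  rw [contMDiffAt_iff] at hf ⊢
  refine ⟨hf.1, ?_⟩
  have h := (hf.2.restrict_scalars ℝ).of_le (m := ∞) le_top
  simpa [extChartAt] using h

/-- A smooth partition of unity, indexed by the points of `X`, subordinate to the charts
`chartAt ℂ c`, `c : X`. -/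
def partitionOfUnity [T2Space X] [CompactSpace X] [IsManifold 𝓘(ℂ) ω X] :
    SmoothPartitionOfUnity X 𝓘(ℝ, ℂ) X univ :=
  haveI := isManifold_real X
  (SmoothPartitionOfUnity.exists_isSubordinate_chartAt_source 𝓘(ℝ, ℂ) X).choose

theorem partitionOfUnity_isSubordinate [T2Space X] [CompactSpace X] [IsManifold 𝓘(ℂ) ω X] :
    (partitionOfUnity X).IsSubordinate fun c => (chartAt ℂ c).source :=
  haveI := isManifold_real X
  (SmoothPartitionOfUnity.exists_isSubordinate_chartAt_source 𝓘(ℝ, ℂ) X).choose_spec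

end RealStructure

section Bundles

variable {X : Type*} [TopologicalSpace X] [ChartedSpace ℂ X]
  (F : Type*) [NormedAddCommGroup F] [NormedSpace ℂ F]
  (W : X → Type*) [∀ x, AddCommGroup (W x)] [∀ x, Module ℂ (W x)] [∀ x, TopologicalSpace (W x)]
  [TopologicalSpace (TotalSpace F W)] [FiberBundle F W]

variable {W} in
/-- The section `s` of `W` is holomorphic on `U`. -/
def IsHolOn (s : ∀ x, W x) (U : Set X) : Prop :=
  ContMDiffOn 𝓘(ℂ) (𝓘(ℂ).prod 𝓘(ℂ, F)) ω (fun x => TotalSpace.mk' F x (s x)) U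

/-- A holomorphic subbundle of `W`: a family of subspaces of the fibres that is locally spanned by
a holomorphic frame. -/
structure Subbundle where
  fiber : ∀ x, Submodule ℂ (W x)
  exists_frame : ∀ x₀, ∃ (r : ℕ) (U : Set X) (s : Fin r → ∀ x, W x), IsOpen U ∧ x₀ ∈ U ∧
    (∀ i, IsHolOn F (s i) U) ∧
    ∀ x ∈ U, LinearIndependent ℂ (fun i => s i x) ∧
      Submodule.span ℂ (range fun i => s i x) = fiber x

/-- A smooth Hermitian metric on the holomorphic vector bundle `W` (antilinear in the first
variable).  Smoothness is that of `h(s, t)` for all local holomorphic sections `s`, `t`. -/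
structure HermitianMetric where
  form : ∀ x, W x →ₗ⋆[ℂ] W x →ₗ[ℂ] ℂ
  conj_symm : ∀ x v w, (starRingEnd ℂ) (form x v w) = form x w v
  pos : ∀ x v, v ≠ 0 → 0 < (form x v v).re
  smooth : ∀ (U : Set X) (s t : ∀ x, W x), IsOpen U → IsHolOn F s U → IsHolOn F t U →
    ContMDiffOn 𝓘(ℝ, ℂ) 𝓘(ℝ, ℂ) ∞ (fun x => form x (s x) (t x)) U

variable {F W}

/-- Auxiliary: the pull-back of the standard Hermitian form of `ℂⁿ` under a linear map. -/
def pullbackForm {M : Type*} [AddCommGroup M] [Module ℂ M] {n : ℕ} (φ : M →ₗ[ℂ] (Fin n → ℂ)) :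
    M →ₗ⋆[ℂ] M →ₗ[ℂ] ℂ :=
  LinearMap.mk₂'ₛₗ (starRingEnd ℂ) (RingHom.id ℂ)
    (fun v w => ∑ i, (starRingEnd ℂ) (φ v i) * φ w i)
    (fun v v' w => by simp [add_mul, Finset.sum_add_distrib])
    (fun c v w => by simp [Finset.mul_sum, mul_assoc])
    (fun v w w' => by simp [mul_add, Finset.sum_add_distrib])
    (fun c v w => by simp [Finset.mul_sum, mul_left_comm])

theorem pullbackForm_apply {M : Type*} [AddCommGroup M] [Module ℂ M] {n : ℕ}
    (φ : M →ₗ[ℂ] (Fin n → ℂ)) (v w : M) :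
    pullbackForm φ v w = ∑ i, (starRingEnd ℂ) (φ v i) * φ w i := rfl

theorem nonempty_hermitianMetric [T2Space X] [CompactSpace X] [IsManifold 𝓘(ℂ) ω X]
    [FiniteDimensional ℂ F] [VectorBundle ℂ F W] [ContMDiffVectorBundle ω F W 𝓘(ℂ)] :
    Nonempty (HermitianMetric F W) := by
  have := isManifold_real X
  obtain ⟨ρ, hρ⟩ := SmoothPartitionOfUnity.exists_isSubordinate 𝓘(ℝ, ℂ) (s := (univ : Set X))
    isClosed_univ (fun c : X => (trivializationAt F W c).baseSet)
    (fun c => (trivializationAt F W c).open_baseSet)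
    (fun x _ => mem_iUnion_of_mem x (mem_baseSet_trivializationAt F W x))
  let b := Module.finBasis ℂ F
  let φ : ∀ c x : X, W x →ₗ[ℂ] (Fin (Module.finrank ℂ F) → ℂ) := fun c x =>
    b.equivFun.toLinearMap ∘ₗ (trivializationAt F W c).linearMapAt ℂ x
  have hφ : ∀ c x, x ∈ (trivializationAt F W c).baseSet → Function.Injective (φ c x) := by
    intro c x hx
    refine b.equivFun.injective.comp ?_
    intro v w hvw
    have h' : (trivializationAt F W c).linearEquivAt ℂ x hx v
        = (trivializationAt F W c).linearEquivAt ℂ x hx w := by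
      simpa [Trivialization.coe_linearMapAt_of_mem _ hx] using hvw
    exact ((trivializationAt F W c).linearEquivAt ℂ x hx).injective h'
  have key : ∀ x v w, (∑ c ∈ ρ.finsupport x, (ρ c x : ℂ) • pullbackForm (φ c x)) v w
      = ∑ c ∈ ρ.finsupport x, (ρ c x : ℂ) * pullbackForm (φ c x) v w := by
    intro x v w
    simp [LinearMap.sum_apply]
  refine ⟨⟨fun x => ∑ c ∈ ρ.finsupport x, (ρ c x : ℂ) • pullbackForm (φ c x), ?_, ?_, ?_⟩⟩
  · intro x v w
    rw [key, key, map_sum]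
    refine Finset.sum_congr rfl fun c _ => ?_
    simp [pullbackForm_apply, mul_comm]
  · intro x v hv
    rw [key, Complex.re_sum]
    have hre : ∀ c, ((ρ c x : ℂ) * pullbackForm (φ c x) v v).re
        = ρ c x * ∑ i, Complex.normSq (φ c x v i) := by
      intro c
      rw [Complex.re_ofReal_mul, pullbackForm_apply, Complex.re_sum]
      congr 1
      refine Finset.sum_congr rfl fun i _ => ?_
      rw [mul_comm, Complex.mul_conj, Complex.ofReal_re]
    simp only [hre]
    obtain ⟨c, hc⟩ := ρ.exists_pos_of_mem (mem_univ x)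
    refine Finset.sum_pos' (fun c _ => mul_nonneg (ρ.nonneg c x)
      (Finset.sum_nonneg fun i _ => Complex.normSq_nonneg _)) ⟨c, ?_, mul_pos hc ?_⟩
    · simpa using hc.ne'
    · have hx : x ∈ (trivializationAt F W c).baseSet :=
        hρ c (subset_tsupport _ (by simpa using hc.ne'))
      have hne : φ c x v ≠ 0 := fun h0 => hv (hφ c x hx (by rw [h0, map_zero]))
      obtain ⟨i, hi⟩ := Function.ne_iff.1 hne
      exact Finset.sum_pos' (fun i _ => Complex.normSq_nonneg _)
        ⟨i, Finset.mem_univ _, Complex.normSq_pos.2 hi⟩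
  · intro U s t hU hs ht x hx
    refine ContMDiffAt.contMDiffWithinAt ?_
    have hloc : ∀ (u : ∀ x, W x), IsHolOn F u U → ∀ c, x ∈ (trivializationAt F W c).baseSet →
        ∀ i, ContMDiffAt 𝓘(ℝ, ℂ) 𝓘(ℝ, ℂ) ∞ (fun y => φ c y (u y) i) x := by
      intro u hu c hc i
      apply contMDiffAt_real
      have h1 : ContMDiffAt 𝓘(ℂ) (𝓘(ℂ).prod 𝓘(ℂ, F)) ω (fun y => TotalSpace.mk' F y (u y)) x :=
        (hu x hx).contMDiffAt (hU.mem_nhds hx)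
      have h2 := ((trivializationAt F W c).contMDiffAt_section_iff hc).1 h1
      let ℓ : F →L[ℂ] ℂ := LinearMap.toContinuousLinearMap (b.coord i)
      have h3 := ℓ.contMDiff.contMDiffAt.comp x h2
      refine h3.congr_of_eventuallyEq ?_
      filter_upwards [(trivializationAt F W c).open_baseSet.mem_nhds hc] with y hy
      simp [φ, ℓ, Trivialization.coe_linearMapAt_of_mem _ hy]
    have hsum := ρ.contMDiffAt_finsum (n := ⊤) (x₀ := x)
      (g := fun c y => pullbackForm (φ c y) (s y) (t y)) (fun c hc => by
        have hxc := hρ c hc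
        simp only [pullbackForm_apply]
        refine ContMDiffAt.sum fun i _ => ?_
        refine (contDiff_mul (𝕜 := ℝ) (𝔸 := ℂ)).comp_contMDiffAt
          (ContMDiffAt.prodMk_space ?_ (hloc t ht c hxc i))
        exact Complex.conjCLE.contDiff.comp_contMDiffAt (hloc s hs c hxc i))
    refine hsum.congr_of_eventuallyEq (Filter.Eventually.of_forall fun y => ?_)
    simp only [key]
    rw [← ρ.sum_finsupport_smul_eq_finsum y fun c y => pullbackForm (φ c y) (s y) (t y)]
    simp

/-- The holomorphic frame of `V` near `x₀` that is used to compute its curvature at `x₀`. -/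
def Subbundle.frame (V : Subbundle F W) (x₀ : X) :
    Fin (V.exists_frame x₀).choose → ∀ x, W x :=
  (V.exists_frame x₀).choose_spec.choose_spec.choose

/-- The Gram determinant `det (h(sᵢ, sⱼ))` (a real number) at `x`. -/
def HermitianMetric.gramDet (h : HermitianMetric F W) {r : ℕ} (s : Fin r → ∀ x, W x) (x : X) : ℝ :=
  (Matrix.det (Matrix.of fun i j => h.form x (s i x) (s j x))).re

/-- The first Chern form of the Chern connection of `(V, h|V)` at `x`, as a multiple of `dx ∧ dy` in
the chart `chartAt ℂ c`.  If `H` is the Gram matrix of a holomorphic frame, this form is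
`(i / 2π) ∂̄∂ log det H = -(1 / 4π) Δ(log det H) dx ∧ dy`. -/
def Subbundle.chernDensity (V : Subbundle F W) (h : HermitianMetric F W) (c x : X) : ℝ :=
  -(1 / (4 * Real.pi)) *
    Laplacian.laplacian
      (fun z : ℂ => Real.log (h.gramDet (V.frame x) ((chartAt ℂ c).symm z))) (chartAt ℂ c x)

/-- The integral over `X` of the first Chern form of `(V, h|V)`, by means of a partition of unity
that is subordinate to the charts. -/
def Subbundle.chernIntegral [T2Space X] [CompactSpace X] [IsManifold 𝓘(ℂ) ω X]
    (V : Subbundle F W) (h : HermitianMetric F W) : ℝ :=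
  ∑ᶠ c : X, ∫ z in (chartAt ℂ c).target,
    partitionOfUnity X c ((chartAt ℂ c).symm z) * V.chernDensity h c ((chartAt ℂ c).symm z)

/-- The degree `deg V = (i / 2π) ∫_X tr F_h` of a holomorphic subbundle `V ⊆ W`, computed with (the
restriction to `V` of) a Hermitian metric on `W`. -/
def Subbundle.degree [T2Space X] [CompactSpace X] [IsManifold 𝓘(ℂ) ω X]
    [FiniteDimensional ℂ F] [VectorBundle ℂ F W] [ContMDiffVectorBundle ω F W 𝓘(ℂ)]
    (V : Subbundle F W) : ℝ :=
  V.chernIntegral (Classical.choice nonempty_hermitianMetric)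

end Bundles

/-! ### `L`-twisted `GL(n, ℝ)`-Higgs pairs -/

section SymmetricProducts

variable {M N : Type*} [AddCommGroup M] [Module ℂ M] [AddCommGroup N] [Module ℂ N]

/-- The product `v · w` in the symmetric square `S² M`. -/
def symMul (v w : M) : Sym[ℂ]^2 M := SymmetricPower.tprod ℂ ![v, w]

variable (N) in
/-- For subspaces `A, B ⊆ M`, the subspace `N ⊗ (A ⊗_S B)` of `N ⊗ S² M`, where `A ⊗_S B` is the
image of `A ⊗ B` in `S² M`. -/
def twistedSymProd (A B : Submodule ℂ M) : Submodule ℂ (N ⊗[ℂ] Sym[ℂ]^2 M) :=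
  Submodule.span ℂ {τ | ∃ l : N, ∃ v ∈ A, ∃ w ∈ B, τ = l ⊗ₜ[ℂ] symMul v w}

end SymmetricProducts

section Pairs

variable {X : Type*} [TopologicalSpace X] [ChartedSpace ℂ X]
  (F : Type*) [NormedAddCommGroup F] [NormedSpace ℂ F]
  (W : X → Type*) [∀ x, AddCommGroup (W x)] [∀ x, Module ℂ (W x)] [∀ x, TopologicalSpace (W x)]
  [TopologicalSpace (TotalSpace F W)] [FiberBundle F W]
  (L : X → Type*) [∀ x, AddCommGroup (L x)] [∀ x, Module ℂ (L x)] [∀ x, TopologicalSpace (L x)]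
  [TopologicalSpace (TotalSpace ℂ L)] [FiberBundle ℂ L]

/-- An `L`-twisted `GL(n, ℝ)`-Higgs pair `((W, Q), ψ)` on `X`: a holomorphic nondegenerate
quadratic form `Q` on `W`, given by its symmetric bilinear form, and a holomorphic section `ψ` of
`L ⊗ S² W`, i.e. one that is locally a finite sum of products `ℓ ⊗ s·t` of holomorphic sections. -/
structure OrthogonalPair where
  Q : ∀ x, LinearMap.BilinForm ℂ (W x)
  symm : ∀ x v w, Q x v w = Q x w v
  nondegenerate : ∀ x, (Q x).Nondegenerate
  holomorphic_Q : ∀ (U : Set X) (s t : ∀ x, W x), IsOpen U → IsHolOn F s U → IsHolOn F t U →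
    ContMDiffOn 𝓘(ℂ) 𝓘(ℂ) ω (fun x => Q x (s x) (t x)) U
  ψ : ∀ x, L x ⊗[ℂ] Sym[ℂ]^2 (W x)
  holomorphic_ψ : ∀ x₀, ∃ (m : ℕ) (U : Set X) (ℓ : Fin m → ∀ x, L x) (s t : Fin m → ∀ x, W x),
    IsOpen U ∧ x₀ ∈ U ∧
    (∀ i, IsHolOn ℂ (ℓ i) U ∧ IsHolOn F (s i) U ∧ IsHolOn F (t i) U) ∧
    ∀ x ∈ U, ψ x = ∑ i, ℓ i x ⊗ₜ[ℂ] symMul (s i x) (t i x)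

variable {F W L}

namespace OrthogonalPair

variable (P : OrthogonalPair F W L)

/-- The fibre at `x` of the orthogonal complement `V^{⊥_Q}`. -/
def perp (V : Subbundle F W) (x : X) : Submodule ℂ (W x) := (P.Q x).orthogonal (V.fiber x)

/-- `V` is isotropic: `Q` vanishes on `V`. -/
def IsIsotropic (V : Subbundle F W) : Prop :=
  ∀ x, ∀ v ∈ V.fiber x, ∀ w ∈ V.fiber x, P.Q x v w = 0

/-- `ψ ∈ H⁰(L ⊗ (S² V^{⊥_Q} + V ⊗_S W))`. -/
def Compatible (V : Subbundle F W) : Prop :=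
  ∀ x, P.ψ x ∈ twistedSymProd (L x) (P.perp V x) (P.perp V x) ⊔ twistedSymProd (L x) (V.fiber x) ⊤

/-- `V 0, …, V k` is a filtration `0 = V₀ ⊊ V₁ ⊊ … ⊊ V_k = W` with `V_j = V_{k-j}^{⊥_Q}`. -/
structure IsFiltration (k : ℕ) (V : ℕ → Subbundle F W) : Prop where
  zero : ∀ x, (V 0).fiber x = ⊥
  top : ∀ x, (V k).fiber x = ⊤
  le : ∀ j < k, ∀ x, (V j).fiber x ≤ (V (j + 1)).fiber x
  ne : ∀ j < k, ∃ x, (V j).fiber x ≠ (V (j + 1)).fiber x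
  perp : ∀ j ≤ k, ∀ x, (V j).fiber x = P.perp (V (k - j)) x

/-- `lam = (lam 1, …, lam k)` belongs to `Λ(𝒲)`: it is weakly increasing, and
`lam i + lam (k - i + 1) = 0`. -/
structure IsWeight (k : ℕ) (lam : ℕ → ℝ) : Prop where
  mono : ∀ i, 1 ≤ i → i < k → lam i ≤ lam (i + 1)
  antisymm : ∀ i, 1 ≤ i → i ≤ k → lam i + lam (k - i + 1) = 0

/-- `ψ ∈ H⁰(N(𝒲, lam))` with `N(𝒲, lam) = ∑_{lam i + lam j ≤ 0} L ⊗ V_i ⊗_S V_j`,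
`1 ≤ i, j ≤ k`. -/
def MemN (k : ℕ) (V : ℕ → Subbundle F W) (lam : ℕ → ℝ) : Prop :=
  ∀ x, P.ψ x ∈ ⨆ (i ∈ Finset.Icc 1 k) (j ∈ Finset.Icc 1 k) (_ : lam i + lam j ≤ 0),
    twistedSymProd (L x) ((V i).fiber x) ((V j).fiber x)

/-- The subbundles `U 1, …, U k` of `W` give a splitting `W ≃ V₁ ⊕ V₂/V₁ ⊕ … ⊕ V_k/V_{k-1}` of the
filtration (`U i ≃ V_i/V_{i-1}`, as `V_i = V_{i-1} ⊕ U i`) such that `Q` pairs the `i`-th and the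
`j`-th summand to zero unless `i + j = k + 1`, and such that
`ψ ∈ H⁰(⨁_{lam i + lam j = 0} L ⊗ U i ⊗_S U j)`. -/
structure IsSplitting (k : ℕ) (V : ℕ → Subbundle F W) (lam : ℕ → ℝ) (U : ℕ → Subbundle F W) :
    Prop where
  disjoint : ∀ i < k, ∀ x, Disjoint ((V i).fiber x) ((U (i + 1)).fiber x)
  sup_eq : ∀ i < k, ∀ x, (V i).fiber x ⊔ (U (i + 1)).fiber x = (V (i + 1)).fiber x
  orthogonal : ∀ i ∈ Finset.Icc 1 k, ∀ j ∈ Finset.Icc 1 k, i + j ≠ k + 1 →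
    ∀ x, ∀ v ∈ (U i).fiber x, ∀ w ∈ (U j).fiber x, P.Q x v w = 0
  mem : ∀ x, P.ψ x ∈ ⨆ (i ∈ Finset.Icc 1 k) (j ∈ Finset.Icc 1 k) (_ : lam i + lam j = 0),
    twistedSymProd (L x) ((U i).fiber x) ((U j).fiber x)

variable [T2Space X] [CompactSpace X] [IsManifold 𝓘(ℂ) ω X]
  [FiniteDimensional ℂ F] [VectorBundle ℂ F W] [ContMDiffVectorBundle ω F W 𝓘(ℂ)]

/-- `d(𝒲, lam) = ∑_{j=1}^{k-1} (lam j - lam (j+1)) deg V_j`. -/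
def weightedDegree (k : ℕ) (V : ℕ → Subbundle F W) (lam : ℕ → ℝ) : ℝ :=
  ∑ j ∈ Finset.Ico 1 k, (lam j - lam (j + 1)) * (V j).degree

/-- Semistability of `((W, Q), ψ)`. -/
def Semistable : Prop :=
  ∀ (k : ℕ) (V : ℕ → Subbundle F W) (lam : ℕ → ℝ), P.IsFiltration k V → IsWeight k lam →
    P.MemN k V lam → 0 ≤ weightedDegree k V lam

/-- Stability of `((W, Q), ψ)`. -/
def Stable : Prop :=
  P.Semistable ∧
  ∀ (k : ℕ) (V : ℕ → Subbundle F W) (lam : ℕ → ℝ), P.IsFiltration k V → IsWeight k lam →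
    (∃ i ∈ Finset.Icc 1 k, lam i ≠ 0) → P.MemN k V lam → 0 < weightedDegree k V lam

/-- Polystability of `((W, Q), ψ)`. -/
def Polystable : Prop :=
  P.Semistable ∧
  ∀ (k : ℕ) (V : ℕ → Subbundle F W) (lam : ℕ → ℝ), P.IsFiltration k V → IsWeight k lam →
    (∀ i, 1 ≤ i → i < k → lam i < lam (i + 1)) → P.MemN k V lam → weightedDegree k V lam = 0 →
    ∃ U : ℕ → Subbundle F W, P.IsSplitting k V lam U

end OrthogonalPair

end Pairs

end HiggsPair

end

/-! After the choice of a generator of the line `L x`, contraction with `Q` turns `ψ x` into an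
endomorphism `T` of `W x` that is self-adjoint for `Q`, and `ψ` is recovered as `½ ∑ eⁱ · T eᵢ` for
dual bases. In these terms an isotropic subbundle is admissible exactly when it is `T`-invariant
(`mem_compatible_iff`), and `ψ ∈ N(𝒲, λ)` makes every step of the filtration at which `λ` jumps
invariant (`mem_invtSubmodule_of_lt`). Orthogonal complements of invariant subspaces are again
invariant.

The analytic input is `deg V^⊥ = deg V` (`degree_perpBundle`). Conceptually, `Q` identifies `W /
V^⊥` with the dual of `V` and trivialises the square of `det W`. For a Hermitian metric this says
that the logarithms of the Gram determinants of `V^⊥` and `V` differ by a global smooth function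
`g`, up to terms `log ‖f‖` with `f` holomorphic and nonvanishing. So the Chern forms differ by a
multiple of `Δg dx ∧ dy`, which integrates to zero by Stokes (`finsum_integral_laplacian_eq_zero`).

In `d(𝒲, λ)` each nonzero coefficient `λ_j - λ_{j+1}` is negative and stands before the degree of an
invariant `V_j`. One of `V_j` and `V_{k-j} = V_j^⊥` is isotropic, hence admissible, and both have
the same degree. Conversely an admissible `W' ≠ 0` gives `0 ⊊ W' ⊆ W'^⊥ ⊊ W` with weights `-1, 0, 1`
(or `-1, 1` if `W' = W'^⊥`) and `d = -2 deg W'`. This proves the criteria for semistability and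
stability.

For polystability, `d = 0` forces all `deg V_j = 0`, so each isotropic step has an invariant
isotropic complement to its orthogonal. These complements are not nested; they are corrected one by
one to an invariant flag `O` opposite to the filtration and self-dual (`exists_opposite`). The
intersections `V_i ∩ O_{k+1-i}` then split everything (`exists_isSplitting`). Conversely, the last
summand of a splitting of the filtration above is the required complement. Two complementary
isotropic subbundles satisfy `W'^⊥ = W'`, so the third claim follows from the fourth. -/

noncomputable section

namespace HiggsPair

/-! ### The endomorphism attached to an element of `L ⊗ S² M` -/

section LinearAlgebra

variable {M N L : Type*} [AddCommGroup M] [Module ℂ M] [AddCommGroup N] [Module ℂ N]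
  [AddCommGroup L] [Module ℂ L]

/-- The linear map out of `S² M` induced by a symmetric bilinear map. -/
def symLift (B : M →ₗ[ℂ] M →ₗ[ℂ] N) (hB : ∀ v w, B v w = B w v) : Sym[ℂ]^2 M →ₗ[ℂ] N :=
  let f : MultilinearMap ℂ (fun _ : Fin 2 => M) N :=
    { toFun := fun v => B (v 0) (v 1)
      map_update_add' := fun {inst} m i x y => by
        -- The decidability instance in this field is arbitrary; the standard one lets
        -- `Function.update` compute.
        rw [Subsingleton.elim inst (instDecidableEqFin 2)]
        fin_cases i <;> simp [Function.update]
      map_update_smul' := fun {inst} m i c x => by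
        rw [Subsingleton.elim inst (instDecidableEqFin 2)]
        fin_cases i <;> simp [Function.update] }
  -- The symmetric power is a quotient by an additive congruence: the map descends additively, and
  -- homogeneity is then checked on representatives.
  let g : Sym[ℂ]^2 M →+ N := AddCon.lift _ (PiTensorProduct.lift f).toAddMonoidHom (by
    refine AddCon.addConGen_le.2 fun x y h => ?_
    obtain ⟨e, v⟩ := h
    have he : (e 0 = 0 ∧ e 1 = 1) ∨ (e 0 = 1 ∧ e 1 = 0) := by
      revert e; decide
    have : f v = f (fun i => v (e i)) := by
      change B (v 0) (v 1) = B (v (e 0)) (v (e 1))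
      rcases he with ⟨h0, h1⟩ | ⟨h0, h1⟩
      · rw [h0, h1]
      · rw [h0, h1, hB]
    simpa using this)
  { toFun := g
    map_add' := g.map_add
    map_smul' := fun c x => by
      induction x using AddCon.induction_on with
      | H x => exact (PiTensorProduct.lift f).map_smul c x }

theorem symLift_symMul (B : M →ₗ[ℂ] M →ₗ[ℂ] N) (hB : ∀ v w, B v w = B w v) (v w : M) :
    symLift B hB (symMul v w) = B v w := by
  change (PiTensorProduct.lift _) (PiTensorProduct.tprod ℂ ![v, w]) = _
  rw [PiTensorProduct.lift.tprod]
  simp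

/-- The product `v · w` as a bilinear map. -/
def symMulₗ : M →ₗ[ℂ] M →ₗ[ℂ] Sym[ℂ]^2 M :=
  have h0 (v w x : M) : Function.update ![v, w] 0 x = ![x, w] := by
    ext i; fin_cases i <;> simp
  have h1 (v w x : M) : Function.update ![v, w] 1 x = ![v, x] := by
    ext i; fin_cases i <;> simp
  LinearMap.mk₂ ℂ symMul
    (fun v v' w => by
      have := (SymmetricPower.tprod ℂ (ι := Fin 2) (M := M)).map_update_add ![v, w] 0 v v'
      rwa [h0, h0, h0] at this)
    (fun c v w => by
      have := (SymmetricPower.tprod ℂ (ι := Fin 2) (M := M)).map_update_smul ![v, w] 0 c v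
      rwa [h0, h0] at this)
    (fun v w w' => by
      have := (SymmetricPower.tprod ℂ (ι := Fin 2) (M := M)).map_update_add ![v, w] 1 w w'
      rwa [h1, h1, h1] at this)
    (fun c v w => by
      have := (SymmetricPower.tprod ℂ (ι := Fin 2) (M := M)).map_update_smul ![v, w] 1 c w
      rwa [h1, h1] at this)

theorem symMulₗ_apply (v w : M) : symMulₗ v w = symMul v w := rfl

theorem symMul_comm (v w : M) : symMul v w = symMul w v := by
  have := SymmetricPower.tprod_equiv (R := ℂ) (Equiv.swap (0 : Fin 2) 1) ![w, v]
  rw [symMul, symMul, ← this]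
  congr 1
  ext i
  fin_cases i <;> simp

theorem span_symMul : Submodule.span ℂ {s | ∃ v w : M, s = symMul v w} = ⊤ := by
  rw [eq_top_iff, ← SymmetricPower.span_tprod_eq_top]
  refine Submodule.span_mono ?_
  rintro _ ⟨f, rfl⟩
  refine ⟨f 0, f 1, ?_⟩
  rw [symMul]
  congr 1
  ext i
  fin_cases i <;> rfl

theorem tmul_symMul_mem {A B : Submodule ℂ M} {v w : M} (hv : v ∈ A) (hw : w ∈ B) (l : N) :
    l ⊗ₜ[ℂ] symMul v w ∈ twistedSymProd N A B :=
  Submodule.subset_span ⟨l, v, hv, w, hw, rfl⟩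

theorem twistedSymProd_mono {A A' B B' : Submodule ℂ M} (hA : A ≤ A') (hB : B ≤ B') :
    twistedSymProd N A B ≤ twistedSymProd N A' B' := by
  refine Submodule.span_mono ?_
  rintro _ ⟨l, v, hv, w, hw, rfl⟩
  exact ⟨l, v, hA hv, w, hB hw, rfl⟩

theorem twistedSymProd_comm (A B : Submodule ℂ M) :
    twistedSymProd N A B = twistedSymProd N B A := by
  refine le_antisymm ?_ ?_ <;>
  · refine Submodule.span_le.2 ?_
    rintro _ ⟨l, v, hv, w, hw, rfl⟩
    rw [symMul_comm]
    exact tmul_symMul_mem hw hv l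

theorem twistedSymProd_top : twistedSymProd N (⊤ : Submodule ℂ M) ⊤ = ⊤ := by
  rw [eq_top_iff, ← TensorProduct.span_tmul_eq_top]
  refine Submodule.span_le.2 ?_
  rintro _ ⟨l, s, rfl⟩
  have hs : s ∈ Submodule.span ℂ {s | ∃ v w : M, s = symMul v w} := by
    rw [span_symMul]; trivial
  induction hs using Submodule.span_induction with
  | mem x hx => obtain ⟨v, w, rfl⟩ := hx; exact tmul_symMul_mem Submodule.mem_top Submodule.mem_top l
  | zero => simp
  | add x y _ _ hx hy => rw [TensorProduct.tmul_add]; exact add_mem hx hy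
  | smul c x _ hx => rw [TensorProduct.tmul_smul]; exact Submodule.smul_mem _ c hx

/-- The endomorphism `z ↦ Q(z, v) w + Q(z, w) v`, as a bilinear map in `v` and `w`. -/
def symContractₗ (Q : LinearMap.BilinForm ℂ M) : M →ₗ[ℂ] M →ₗ[ℂ] M →ₗ[ℂ] M :=
  LinearMap.mk₂ ℂ (fun v w => (Q.flip v).smulRight w + (Q.flip w).smulRight v)
    (fun v v' w => by ext; simp [add_smul]; abel)
    (fun c v w => by ext; simp [mul_smul, smul_comm c])
    (fun v w w' => by ext; simp [add_smul]; abel)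
    (fun c v w => by ext; simp [mul_smul, smul_comm c])

theorem symContractₗ_apply (Q : LinearMap.BilinForm ℂ M) (v w z : M) :
    symContractₗ Q v w z = Q z v • w + Q z w • v := rfl

theorem symContractₗ_comm (Q : LinearMap.BilinForm ℂ M) (v w : M) :
    symContractₗ Q v w = symContractₗ Q w v := by
  ext z
  rw [symContractₗ_apply, symContractₗ_apply, add_comm]

/-- The contraction of `v · w` with a symmetric bilinear form `Q`: the endomorphism
`z ↦ Q(z, v) w + Q(z, w) v`. -/
def symContract (Q : LinearMap.BilinForm ℂ M) : Sym[ℂ]^2 M →ₗ[ℂ] M →ₗ[ℂ] M :=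
  symLift (symContractₗ Q) (symContractₗ_comm Q)

theorem symContract_symMul (Q : LinearMap.BilinForm ℂ M) (v w z : M) :
    symContract Q (symMul v w) z = Q z v • w + Q z w • v := by
  rw [symContract, symLift_symMul, symContractₗ_apply]

/-- The endomorphism attached to `ψ ∈ L ⊗ S² M`, for a line `L` with generator `ℓ⁻¹ 1`. -/
def twistedContract (Q : LinearMap.BilinForm ℂ M) (ℓ : L ≃ₗ[ℂ] ℂ) :
    L ⊗[ℂ] Sym[ℂ]^2 M →ₗ[ℂ] M →ₗ[ℂ] M :=
  TensorProduct.lift (LinearMap.mk₂ ℂ (fun l s => ℓ l • symContract Q s)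
    (fun l l' s => by simp [add_smul]) (fun c l s => by simp [mul_smul])
    (fun l s s' => by simp) (fun c l s => by simp [smul_comm c]))

theorem twistedContract_tmul (Q : LinearMap.BilinForm ℂ M) (ℓ : L ≃ₗ[ℂ] ℂ) (l : L) (v w z : M) :
    twistedContract Q ℓ (l ⊗ₜ symMul v w) z = ℓ l • (Q z v • w + Q z w • v) := by
  simp [twistedContract, symContract_symMul]

/-- An induction principle for `twistedSymProd`, in the form of containment in a submodule. -/
theorem twistedSymProd_le {A B : Submodule ℂ M} {S : Submodule ℂ (N ⊗[ℂ] Sym[ℂ]^2 M)} :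
    twistedSymProd N A B ≤ S ↔ ∀ l : N, ∀ v ∈ A, ∀ w ∈ B, l ⊗ₜ symMul v w ∈ S := by
  rw [twistedSymProd, Submodule.span_le]
  exact ⟨fun h l v hv w hw => h ⟨l, v, hv, w, hw, rfl⟩,
    by rintro h _ ⟨l, v, hv, w, hw, rfl⟩; exact h l v hv w hw⟩

/-- The elements whose endomorphism maps `A` to `B`. -/
def contractMapsTo (Q : LinearMap.BilinForm ℂ M) (ℓ : L ≃ₗ[ℂ] ℂ) (A B : Submodule ℂ M) :
    Submodule ℂ (L ⊗[ℂ] Sym[ℂ]^2 M) where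
  carrier := {ψ | ∀ z ∈ A, twistedContract Q ℓ ψ z ∈ B}
  add_mem' h h' z hz := by simpa using add_mem (h z hz) (h' z hz)
  zero_mem' z _ := by simp
  smul_mem' c ψ h z hz := by simpa using B.smul_mem c (h z hz)

/-- On `l ⊗ v · w` both sides are `ℓ l (Q(z, v) Q(w, z') + Q(z, w) Q(v, z'))`. Self-adjointness is
what makes orthogonal complements of invariant subspaces invariant. -/
theorem twistedContract_symm {Q : LinearMap.BilinForm ℂ M} (hQ : ∀ v w, Q v w = Q w v)
    (ℓ : L ≃ₗ[ℂ] ℂ) (ψ : L ⊗[ℂ] Sym[ℂ]^2 M) (z z' : M) :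
    Q (twistedContract Q ℓ ψ z) z' = Q z (twistedContract Q ℓ ψ z') := by
  have h : ψ ∈ twistedSymProd L (⊤ : Submodule ℂ M) ⊤ := by
    rw [twistedSymProd_top]; trivial
  induction h using Submodule.span_induction with
  | mem x hx =>
    obtain ⟨l, v, -, w, -, rfl⟩ := hx
    simp only [twistedContract_tmul, map_smul, map_add, LinearMap.smul_apply, LinearMap.add_apply,
      smul_eq_mul, hQ z' v, hQ z' w]
    ring
  | zero => simp
  | add x y _ _ hx hy => simp [hx, hy]
  | smul c x _ hx => simp [hx]

theorem sum_dualBasis_smul {ι : Type*} [Fintype ι] [DecidableEq ι]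
    {Q : LinearMap.BilinForm ℂ M} (hQ : ∀ v w, Q v w = Q w v) (hn : Q.Nondegenerate)
    (b : Module.Basis ι ℂ M) (v : M) : ∑ i, Q (b i) v • Q.dualBasis hn b i = v := by
  have := (Q.dualBasis hn b).sum_repr v
  simpa [LinearMap.BilinForm.dualBasis_repr_apply, hQ v] using this

/-- `ψ` is recovered from its endomorphism `T`: it is `1/2 ∑ eⁱ · T eᵢ` for dual bases. -/
theorem eq_sum_dualBasis {ι : Type*} [Fintype ι] [DecidableEq ι]
    {Q : LinearMap.BilinForm ℂ M} (hQ : ∀ v w, Q v w = Q w v) (hn : Q.Nondegenerate)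
    (b : Module.Basis ι ℂ M) (ℓ : L ≃ₗ[ℂ] ℂ) (ψ : L ⊗[ℂ] Sym[ℂ]^2 M) :
    ψ = (1 / 2 : ℂ) • ∑ i, ℓ.symm 1 ⊗ₜ[ℂ] symMul (Q.dualBasis hn b i)
      (twistedContract Q ℓ ψ (b i)) := by
  simp only [← symMulₗ_apply]
  have h : ψ ∈ twistedSymProd L (⊤ : Submodule ℂ M) ⊤ := by
    rw [twistedSymProd_top]; trivial
  induction h using Submodule.span_induction with
  | mem x hx =>
    obtain ⟨l, v, -, w, -, rfl⟩ := hx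
    -- Contracting against dual bases reproduces `v · w`. The endomorphism of `v · w` has two such
    -- terms, whence the factor `1/2`.
    have key : ∀ v w : M, ∑ i, symMulₗ (Q.dualBasis hn b i) (Q (b i) v • w) = symMul v w := by
      intro v w
      conv_rhs => rw [← symMulₗ_apply, ← sum_dualBasis_smul hQ hn b v]
      simp
    rw [← TensorProduct.tmul_sum]
    simp only [twistedContract_tmul, LinearMap.map_smul (symMulₗ _) (ℓ l),
      LinearMap.map_add (symMulₗ _)]
    rw [← Finset.smul_sum, Finset.sum_add_distrib, key, key, symMul_comm w v, ← two_smul ℂ,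
      TensorProduct.tmul_smul, TensorProduct.smul_tmul', TensorProduct.tmul_smul, smul_smul,
      ← map_smul]
    simp
  | zero => simp
  | add x y _ _ hx hy =>
    conv_lhs => rw [hx, hy]
    simp [TensorProduct.tmul_add, Finset.sum_add_distrib]
  | smul c x _ hx =>
    conv_lhs => rw [hx]
    rw [smul_comm, Finset.smul_sum]
    simp [TensorProduct.tmul_smul]

theorem isRefl_of_symm {Q : LinearMap.BilinForm ℂ M} (hQ : ∀ v w, Q v w = Q w v) : Q.IsRefl :=
  fun v w h => by rw [hQ, h]

theorem orthogonal_mem_invtSubmodule {Q : LinearMap.BilinForm ℂ M} (hQ : ∀ v w, Q v w = Q w v)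
    {ℓ : L ≃ₗ[ℂ] ℂ} {ψ : L ⊗[ℂ] Sym[ℂ]^2 M} {V : Submodule ℂ M}
    (hV : V ∈ Module.End.invtSubmodule (twistedContract Q ℓ ψ)) :
    Q.orthogonal V ∈ Module.End.invtSubmodule (twistedContract Q ℓ ψ) := by
  intro z hz v hv
  change Q v (twistedContract Q ℓ ψ z) = 0
  rw [← twistedContract_symm hQ]
  exact hz _ (hV hv)

end LinearAlgebra
end HiggsPair
end

noncomputable section

namespace HiggsPair

/-! ### Invariant subspaces and the position of `ψ` in `L ⊗ S² M` -/

section InvariantSubspaces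

variable {M L : Type*} [AddCommGroup M] [Module ℂ M] [AddCommGroup L] [Module ℂ L]
  {Q : LinearMap.BilinForm ℂ M}

theorem mem_orthogonal_comm (hQ : ∀ v w, Q v w = Q w v) {A : Submodule ℂ M} {v : M} :
    v ∈ Q.orthogonal A ↔ ∀ w ∈ A, Q v w = 0 := by
  rw [LinearMap.BilinForm.mem_orthogonal_iff]
  refine forall₂_congr fun w _ => ?_
  rw [hQ]

theorem orthogonal_orthogonal [FiniteDimensional ℂ M] (hQ : ∀ v w, Q v w = Q w v)
    (hn : Q.Nondegenerate) (A : Submodule ℂ M) : Q.orthogonal (Q.orthogonal A) = A :=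
  LinearMap.BilinForm.orthogonal_orthogonal hn (isRefl_of_symm hQ) A

theorem eq_zero_of_forall_iSup_eq_top (hn : Q.Nondegenerate) {ι : Type*}
    {U : ι → Submodule ℂ M} (hU : ⨆ i, U i = ⊤) {v : M} (hv : ∀ i, ∀ w ∈ U i, Q v w = 0) :
    v = 0 := by
  refine hn.1 v fun w => ?_
  have hw : w ∈ ⨆ i, U i := hU ▸ Submodule.mem_top
  induction hw using Submodule.iSup_induction' with
  | mem i w hw => exact hv i w hw
  | zero => simp
  | add x y _ _ hx hy => simp [hx, hy]

/-- If `M` is the direct sum of the `U a`, then `ψ` lies in `∑ L ⊗ (⨁_{b ≠ a} U b)^⊥ ⊗_S T (U a)`. -/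
theorem mem_iSup_twistedSymProd [FiniteDimensional ℂ M] (hQ : ∀ v w, Q v w = Q w v)
    (hn : Q.Nondegenerate) (ℓ : L ≃ₗ[ℂ] ℂ) {ι : Type*} [Finite ι]
    {U A B : ι → Submodule ℂ M} (hind : iSupIndep U) (htop : ⨆ a, U a = ⊤)
    (ψ : L ⊗[ℂ] Sym[ℂ]^2 M) (hA : ∀ a v, (∀ b ≠ a, ∀ w ∈ U b, Q v w = 0) → v ∈ A a)
    (hB : ∀ a, ∀ z ∈ U a, twistedContract Q ℓ ψ z ∈ B a) :
    ψ ∈ ⨆ a, twistedSymProd L (A a) (B a) := by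
  classical
  have := Fintype.ofFinite ι
  have hint := DirectSum.isInternal_submodule_of_iSupIndep_of_iSup_eq_top hind htop
  let b := hint.collectedBasis fun a => Module.finBasis ℂ (U a)
  rw [eq_sum_dualBasis hQ hn b ℓ ψ]
  refine Submodule.smul_mem _ _ (Submodule.sum_mem _ fun i _ => ?_)
  refine Submodule.mem_iSup_of_mem i.1 (tmul_symMul_mem (hA _ _ fun c hc w hw => ?_)
    (hB _ _ (hint.collectedBasis_mem _ i)) _)
  -- Pairing `w` with the dual vector `eⁱ` reads off the `i`-th coordinate of `w` in `b`, which
  -- vanishes for `w` in another summand.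
  have := LinearMap.BilinForm.dualBasis_repr_apply (B := Q) hn (Q.dualBasis hn b) w i
  rw [LinearMap.BilinForm.dualBasis_dualBasis hn ⟨hQ⟩] at this
  rw [hQ, ← this]
  exact hint.collectedBasis_repr_of_mem_ne _ hc hw

/-- Tensors in `S² V^⊥` contract `V` to zero, and those in `V ⊗_S M` contract the isotropic `V` into
itself. Conversely write `M = V ⊕ A ⊕ B` with `V ⊕ A = V^⊥`. The dual vectors belonging to `V`, `A`,
`B` lie in `M`, `V^⊥`, `V`, while `T` maps these summands to `V`, `V^⊥`, `M`; the three groups of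
terms in `½ ∑ eⁱ · T eᵢ` are therefore of the required types. -/
theorem mem_compatible_iff [FiniteDimensional ℂ M] (hQ : ∀ v w, Q v w = Q w v)
    (hn : Q.Nondegenerate) (ℓ : L ≃ₗ[ℂ] ℂ) (ψ : L ⊗[ℂ] Sym[ℂ]^2 M) {V : Submodule ℂ M}
    (hV : V ≤ Q.orthogonal V) :
    ψ ∈ twistedSymProd L (Q.orthogonal V) (Q.orthogonal V) ⊔ twistedSymProd L V ⊤ ↔
      V ∈ Module.End.invtSubmodule (twistedContract Q ℓ ψ) := by
  constructor
  · intro h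
    suffices twistedSymProd L (Q.orthogonal V) (Q.orthogonal V) ⊔ twistedSymProd L V ⊤ ≤
      contractMapsTo Q ℓ V V from this h
    refine sup_le (twistedSymProd_le.2 ?_) (twistedSymProd_le.2 ?_)
    · intro l v hv w hw z hz
      rw [twistedContract_tmul, hv z hz, hw z hz]
      simp
    · intro l v hv w _ z hz
      rw [twistedContract_tmul, hV hv z hz]
      simpa using V.smul_mem _ (V.smul_mem _ hv)
  · intro h
    obtain ⟨B, hB⟩ := (Q.orthogonal V).exists_isCompl
    obtain ⟨A', hA'⟩ := V.exists_isCompl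
    set A := A' ⊓ Q.orthogonal V
    have hVA : V ⊔ A = Q.orthogonal V := by
      rw [← sup_inf_assoc_of_le _ hV, hA'.sup_eq_top, top_inf_eq]
    have hA : Disjoint V A := hA'.disjoint.mono_right inf_le_left
    have hind : iSupIndep ![V, A, B] := by
      have h1 : Disjoint V (A ⊔ B) :=
        hA.disjoint_sup_right_of_disjoint_sup_left (hVA ▸ hB.disjoint)
      have h2 : Disjoint A (V ⊔ B) :=
        hA.symm.disjoint_sup_right_of_disjoint_sup_left (by rw [sup_comm, hVA]; exact hB.disjoint)
      have h3 : Disjoint B (V ⊔ A) := hVA ▸ hB.disjoint.symm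
      exact iSupIndep_fin_three.2 ⟨h1, by simpa [sup_comm] using h2, h3⟩
    have htop : ⨆ a, ![V, A, B] a = ⊤ := by
      simp [hVA, hB.sup_eq_top]
    have := mem_iSup_twistedSymProd hQ hn ℓ hind htop ψ
      (A := ![⊤, Q.orthogonal V, V]) (B := ![V, Q.orthogonal V, ⊤]) ?_ ?_
    · refine SetLike.le_def.1 (iSup_le fun a => ?_) this
      fin_cases a
      · exact (twistedSymProd_comm _ _).trans_le le_sup_right
      · exact le_sup_left
      · exact le_sup_right
    · intro a v hv
      fin_cases a
      · trivial
      · exact (mem_orthogonal_comm hQ).2 (hv 0 (by decide))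
      · change v ∈ V
        rw [← orthogonal_orthogonal hQ hn V, mem_orthogonal_comm hQ, ← hVA]
        intro w hw
        obtain ⟨x, hx, y, hy, rfl⟩ := Submodule.mem_sup.1 hw
        rw [map_add, hv 0 (by decide) x hx, hv 1 (by decide) y hy, add_zero]
    · intro a z hz
      fin_cases a
      · exact h hz
      · exact orthogonal_mem_invtSubmodule hQ h (inf_le_right (a := A') hz)
      · trivial

theorem IsWeight.le {k : ℕ} {lam : ℕ → ℝ} (h : OrthogonalPair.IsWeight k lam) {a b : ℕ}
    (ha : 1 ≤ a) (hab : a ≤ b) (hb : b ≤ k) : lam a ≤ lam b := by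
  induction b, hab using Nat.le_induction with
  | base => rfl
  | succ b hab ih => exact (ih (by omega)).trans (h.mono b (by omega) (by omega))

/-- If `ψ` lies in `N(𝒱, lam)`, its endomorphism preserves the steps where `lam` jumps. -/
theorem mem_invtSubmodule_of_lt {ℓ : L ≃ₗ[ℂ] ℂ} {ψ : L ⊗[ℂ] Sym[ℂ]^2 M} {k : ℕ}
    {V : ℕ → Submodule ℂ M} {lam : ℕ → ℝ} (hmono : ∀ i j, i ≤ j → j ≤ k → V i ≤ V j)
    (hperp : ∀ i ≤ k, V i = Q.orthogonal (V (k - i))) (hlam : OrthogonalPair.IsWeight k lam)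
    (hψ : ψ ∈ ⨆ (i ∈ Finset.Icc 1 k) (j ∈ Finset.Icc 1 k) (_ : lam i + lam j ≤ 0),
      twistedSymProd L (V i) (V j)) {j : ℕ} (h1 : 1 ≤ j) (hj : j < k) (hlt : lam j < lam (j + 1)) :
    V j ∈ Module.End.invtSubmodule (twistedContract Q ℓ ψ) := by
  have key : ∀ a ∈ Finset.Icc 1 k, ∀ b ∈ Finset.Icc 1 k, lam a + lam b ≤ 0 →
      ∀ v ∈ V a, ∀ w ∈ V b, ∀ z ∈ V j, Q z v • w ∈ V j := by
    intro a ha b hb hab v hv w hw z hz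
    rw [Finset.mem_Icc] at ha hb
    -- Either `V a ≤ V (k - j) = (V j)^⊥` and the pairing vanishes, or `lam a ≥ lam (k - j + 1) =
    -- -lam j`. In the second case `lam b ≤ lam j < lam (j + 1)`, so `b ≤ j`.
    rcases le_or_gt a (k - j) with h | h
    · have : Q z v = 0 := by
        have := hmono a (k - j) h (by omega) hv
        rw [hperp (k - j) (by omega), Nat.sub_sub_self hj.le] at this
        exact this z hz
      simp [this]
    · have h2 := hlam.antisymm j h1 hj.le
      have h3 := IsWeight.le hlam (a := k - j + 1) (b := a) (by omega) (by omega) ha.2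
      have h4 : b ≤ j := by
        by_contra hb'
        have := IsWeight.le hlam (a := j + 1) (b := b) (by omega) (by omega) hb.2
        linarith
      exact Submodule.smul_mem _ _ (hmono b j h4 hj.le hw)
  suffices (⨆ (i ∈ Finset.Icc 1 k) (j ∈ Finset.Icc 1 k) (_ : lam i + lam j ≤ 0),
      twistedSymProd L (V i) (V j)) ≤ contractMapsTo Q ℓ (V j) (V j) from this hψ
  refine iSup₂_le fun a ha => iSup₂_le fun b hb => iSup_le fun hab => twistedSymProd_le.2 ?_
  intro l v hv w hw z hz
  rw [twistedContract_tmul]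
  exact Submodule.smul_mem _ _ (add_mem (key a ha b hb hab v hv w hw z hz)
    (key b hb a ha (by rwa [add_comm]) w hw v hv z hz))

/-- A decomposition of `M` into invariant subspaces that is compatible with `Q` decomposes `ψ`. -/
theorem mem_iSup_of_splitting [FiniteDimensional ℂ M] (hQ : ∀ v w, Q v w = Q w v)
    (hn : Q.Nondegenerate) (ℓ : L ≃ₗ[ℂ] ℂ) {ψ : L ⊗[ℂ] Sym[ℂ]^2 M} {k : ℕ}
    {U : ℕ → Submodule ℂ M} (htop : ⨆ i : Finset.Icc 1 k, U i = ⊤)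
    (horth : ∀ i ∈ Finset.Icc 1 k, ∀ j ∈ Finset.Icc 1 k, i + j ≠ k + 1 →
      ∀ v ∈ U i, ∀ w ∈ U j, Q v w = 0)
    (hinv : ∀ i ∈ Finset.Icc 1 k, U i ∈ Module.End.invtSubmodule (twistedContract Q ℓ ψ)) :
    ψ ∈ ⨆ i : Finset.Icc 1 k, twistedSymProd L (U (k + 1 - i)) (U i) := by
  have hz : ∀ i : Finset.Icc 1 k, ∀ v ∈ ⨆ (b : Finset.Icc 1 k) (_ : b ≠ i), U b,
      ∀ w ∈ U (k + 1 - i), Q v w = 0 := by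
    intro i v hv w hw
    have hi := Finset.mem_Icc.1 i.2
    suffices ⨆ (b : Finset.Icc 1 k) (_ : b ≠ i), U b ≤ LinearMap.ker (Q.flip w) from this hv
    refine iSup₂_le fun b hb v hv => ?_
    have hb' : (b : ℕ) ≠ i := fun h => hb (Subtype.ext h)
    refine horth b b.2 (k + 1 - i) (Finset.mem_Icc.2 (by omega)) (by omega) v hv w hw
  -- A vector of `U i` that is also a sum of vectors of the other summands is orthogonal to `U (k +
  -- 1 - i)` for the second reason and to all other `U j` for the first, hence is zero.
  have hind : iSupIndep fun i : Finset.Icc 1 k => U i := by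
    intro i
    have hi := Finset.mem_Icc.1 i.2
    rw [Submodule.disjoint_def]
    intro v hv hv'
    refine eq_zero_of_forall_iSup_eq_top hn htop fun j w hw => ?_
    rcases eq_or_ne (j : ℕ) (k + 1 - i) with h | h
    · exact hz i v hv' w (h ▸ hw)
    · exact horth i i.2 j j.2 (by omega) v hv w hw
  refine mem_iSup_twistedSymProd hQ hn ℓ hind htop ψ (fun i v hv => ?_) fun i => hinv i i.2
  have hi := Finset.mem_Icc.1 i.2
  let i' : Finset.Icc 1 k := ⟨k + 1 - i, Finset.mem_Icc.2 (by omega)⟩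
  have hv' : v ∈ ⨆ i : Finset.Icc 1 k, U i := htop ▸ Submodule.mem_top
  -- The part `z` of `v` outside `U (k + 1 - i)` is orthogonal to `U i`, as it lies in the sum of
  -- the other summands, and to every other `U j`, as `v` and `y` are. So the dual vectors of `U i`
  -- lie in `U (k + 1 - i)`.
  rw [iSup_split_single _ i'] at hv'
  obtain ⟨y, hy, z, hz', rfl⟩ := Submodule.mem_sup.1 hv'
  suffices z = 0 by rwa [this, add_zero]
  refine eq_zero_of_forall_iSup_eq_top hn htop fun j w hw => ?_
  rcases eq_or_ne j i with rfl | h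
  · refine hz i' z hz' w ?_
    rwa [show k + 1 - (i' : ℕ) = j by simp only [i']; omega]
  · have h' : (j : ℕ) ≠ i := fun h' => h (Subtype.ext h')
    have h1 := hv j h w hw
    rw [map_add, LinearMap.add_apply, horth i' i'.2 j j.2 (by simp only [i']; omega) y hy w hw,
      zero_add] at h1
    exact h1

end InvariantSubspaces
end HiggsPair
end

noncomputable section

namespace HiggsPair

set_option linter.unusedSectionVars false

/-! ### Holomorphic sections and constructions of subbundles -/

section Determinants

theorem contDiff_det {𝕜 : Type*} [NontriviallyNormedField 𝕜] [NormedAlgebra 𝕜 ℂ] {n : WithTop ℕ∞}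
    {ι : Type*} [Fintype ι] [DecidableEq ι] :
    ContDiff 𝕜 n (fun A : ι → ι → ℂ => Matrix.det (Matrix.of A)) := by
  simp only [Matrix.det_apply, Matrix.of_apply]
  refine ContDiff.sum fun σ _ => ContDiff.const_smul _ (contDiff_prod fun i _ => ?_)
  fun_prop

theorem contMDiffOn_det {X : Type*} [TopologicalSpace X] [ChartedSpace ℂ X] {U : Set X}
    {ι : Type*} [Fintype ι] [DecidableEq ι] {A : X → Matrix ι ι ℂ}
    (h : ∀ i j, ContMDiffOn 𝓘(ℂ) 𝓘(ℂ) ω (fun x => A x i j) U) :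
    ContMDiffOn 𝓘(ℂ) 𝓘(ℂ) ω (fun x => (A x).det) U :=
  (ContDiff.contMDiff (contDiff_det (𝕜 := ℂ) (n := ω))).comp_contMDiffOn
    (f := fun x i j => A x i j)
    (contMDiffOn_pi_space.2 fun i => contMDiffOn_pi_space.2 fun j => h i j)

theorem contMDiffOn_det_real {X : Type*} [TopologicalSpace X] [ChartedSpace ℂ X] {U : Set X}
    {ι : Type*} [Fintype ι] [DecidableEq ι] {A : X → Matrix ι ι ℂ}
    (h : ∀ i j, ContMDiffOn 𝓘(ℝ, ℂ) 𝓘(ℝ, ℂ) ∞ (fun x => A x i j) U) :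
    ContMDiffOn 𝓘(ℝ, ℂ) 𝓘(ℝ, ℂ) ∞ (fun x => (A x).det) U :=
  (ContDiff.contMDiff (contDiff_det (𝕜 := ℝ) (n := ∞))).comp_contMDiffOn
    (f := fun x i j => A x i j)
    (contMDiffOn_pi_space.2 fun i => contMDiffOn_pi_space.2 fun j => h i j)

end Determinants

section Sections

variable {X : Type*} [TopologicalSpace X] [ChartedSpace ℂ X]
  {F : Type*} [NormedAddCommGroup F] [NormedSpace ℂ F]
  {W : X → Type*} [∀ x, AddCommGroup (W x)] [∀ x, Module ℂ (W x)] [∀ x, TopologicalSpace (W x)]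
  [TopologicalSpace (TotalSpace F W)] [FiberBundle F W] [VectorBundle ℂ F W]

variable (F W) in
theorem finiteDimensional_fiber [FiniteDimensional ℂ F] (x : X) : FiniteDimensional ℂ (W x) :=
  (((trivializationAt F W x).linearEquivAt ℂ x
    (mem_baseSet_trivializationAt F W x)).symm).finiteDimensional

theorem Subbundle.ext {V V' : Subbundle F W} (h : ∀ x, V.fiber x = V'.fiber x) : V = V' := by
  obtain ⟨f, _⟩ := V
  obtain ⟨f', _⟩ := V'
  obtain rfl : f = f' := funext h
  rfl

theorem IsHolOn.mono {s : ∀ x, W x} {U U' : Set X} (h : IsHolOn F s U) (hU : U' ⊆ U) :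
    IsHolOn F s U' :=
  ContMDiffOn.mono h hU

variable [ContMDiffVectorBundle ω F W 𝓘(ℂ)]

variable (F) in
/-- Every vector extends to a local holomorphic section. -/
theorem exists_isHolOn_eq (x₀ : X) : ∃ U : Set X, IsOpen U ∧ x₀ ∈ U ∧
    ∀ v : W x₀, ∃ s : ∀ x, W x, IsHolOn F s U ∧ s x₀ = v := by
  let e := trivializationAt F W x₀
  refine ⟨e.baseSet, e.open_baseSet, mem_baseSet_trivializationAt F W x₀, fun v =>
    ⟨fun x => e.symm x (e ⟨x₀, v⟩).2, ?_, ?_⟩⟩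
  · rw [IsHolOn, e.contMDiffOn_section_baseSet_iff]
    refine (contMDiffOn_const (c := (e ⟨x₀, v⟩).2)).congr fun y hy => ?_
    rw [e.apply_mk_symm hy]
  · exact e.symm_apply_apply_mk (mem_baseSet_trivializationAt F W x₀) v

theorem IsHolOn.sub {s t : ∀ x, W x} {U : Set X} (hs : IsHolOn F s U) (ht : IsHolOn F t U) :
    IsHolOn F (fun x => s x - t x) U :=
  ContMDiffOn.sub_section hs ht

theorem IsHolOn.smul {s : ∀ x, W x} {U : Set X} {f : X → ℂ}
    (hf : ContMDiffOn 𝓘(ℂ) 𝓘(ℂ) ω f U) (hs : IsHolOn F s U) :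
    IsHolOn F (fun x => f x • s x) U :=
  ContMDiffOn.smul_section hf hs

theorem IsHolOn.sum {ι : Type*} {a : Finset ι} {s : ι → ∀ x, W x} {U : Set X}
    (hs : ∀ i ∈ a, IsHolOn F (s i) U) : IsHolOn F (fun x => ∑ i ∈ a, s i x) U :=
  ContMDiffOn.sum_section hs

/-- Linear independence of holomorphic sections is an open condition. -/
theorem eventually_linearIndependent {ι : Type*} [Finite ι] {s : ι → ∀ x, W x} {U : Set X}
    (hU : IsOpen U) (hs : ∀ i, IsHolOn F (s i) U) {x₀ : X} (hx₀ : x₀ ∈ U)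
    (h : LinearIndependent ℂ fun i => s i x₀) :
    ∀ᶠ x in 𝓝 x₀, LinearIndependent ℂ fun i => s i x := by
  have := Fintype.ofFinite ι
  let e := trivializationAt F W x₀
  have hmem := mem_baseSet_trivializationAt F W x₀
  have hc : ContinuousAt (fun x i => (e ⟨x, s i x⟩).2) x₀ := by
    refine continuousAt_pi.2 fun i => ?_
    exact ((e.contMDiffAt_section_iff hmem).1
      ((hs i x₀ hx₀).contMDiffAt (hU.mem_nhds hx₀))).continuousAt
  have key : ∀ x ∈ e.baseSet, (LinearIndependent ℂ (fun i => (e ⟨x, s i x⟩).2) ↔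
      LinearIndependent ℂ fun i => s i x) := by
    intro x hx
    rw [← LinearMap.linearIndependent_iff (e.linearEquivAt ℂ x hx).toLinearMap
      (LinearMap.ker_eq_bot.2 (e.linearEquivAt ℂ x hx).injective)]
    rfl
  have h1 := hc.eventually (isOpen_setOfPred_linearIndependent.eventually_mem ((key x₀ hmem).2 h))
  filter_upwards [h1, e.open_baseSet.mem_nhds hmem] with x hx hx'
  exact (key x hx').1 hx

variable [FiniteDimensional ℂ F]

/-- A family of subspaces is a subbundle if near each point it contains holomorphic sections that
are linearly independent there, as many as its dimension. -/
def Subbundle.mk' (f : ∀ x, Submodule ℂ (W x))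
    (hf : ∀ x₀, ∃ (n : ℕ) (U : Set X) (s : Fin n → ∀ x, W x), IsOpen U ∧ x₀ ∈ U ∧
      (∀ i, IsHolOn F (s i) U) ∧ (LinearIndependent ℂ fun i => s i x₀) ∧
      ∀ x ∈ U, (∀ i, s i x ∈ f x) ∧ Module.finrank ℂ (f x) = n) : Subbundle F W where
  fiber := f
  exists_frame x₀ := by
    obtain ⟨n, U, s, hU, hx₀, hs, hli, hmem⟩ := hf x₀
    obtain ⟨U', hU', hU'o, hx₀'⟩ := eventually_nhds_iff.1 (eventually_linearIndependent hU hs hx₀ hli)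
    refine ⟨n, U ∩ U', s, hU.inter hU'o, ⟨hx₀, hx₀'⟩, fun i => (hs i).mono inter_subset_left,
      fun x hx => ⟨hU' x hx.2, ?_⟩⟩
    have := finiteDimensional_fiber F W x
    refine Submodule.eq_of_le_of_finrank_eq
      (Submodule.span_le.2 (range_subset_iff.2 (hmem x hx.1).1)) ?_
    rw [finrank_span_eq_card (hU' x hx.2), (hmem x hx.1).2, Fintype.card_fin]

theorem Subbundle.finrank_eq_of_frame {V : Subbundle F W} {x : X} {r : ℕ} {s : Fin r → W x}
    (h : LinearIndependent ℂ s ∧ Submodule.span ℂ (range s) = V.fiber x) :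
    Module.finrank ℂ (V.fiber x) = r := by
  rw [← h.2, finrank_span_eq_card h.1, Fintype.card_fin]

variable (F W) in
/-- The zero subbundle. -/
def Subbundle.bot : Subbundle F W :=
  Subbundle.mk' (fun _ => ⊥) fun _ =>
    ⟨0, univ, Fin.elim0, isOpen_univ, trivial, fun i => i.elim0, linearIndependent_empty_type,
      fun _ _ => ⟨fun i => i.elim0, finrank_bot ℂ _⟩⟩

/-- The direct sum of two subbundles with trivial intersection. -/
def Subbundle.sup (V V' : Subbundle F W) (h : ∀ x, Disjoint (V.fiber x) (V'.fiber x)) :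
    Subbundle F W where
  fiber x := V.fiber x ⊔ V'.fiber x
  exists_frame x₀ := by
    obtain ⟨r, U, s, hU, hx₀, hs, hfr⟩ := V.exists_frame x₀
    obtain ⟨r', U', s', hU', hx₀', hs', hfr'⟩ := V'.exists_frame x₀
    refine ⟨r + r', U ∩ U', Fin.append s s', hU.inter hU', ⟨hx₀, hx₀'⟩, ?_, ?_⟩
    · intro i
      refine Fin.addCases (fun i => ?_) (fun i => ?_) i
      · rw [Fin.append_left]; exact (hs i).mono inter_subset_left
      · rw [Fin.append_right]; exact (hs' i).mono inter_subset_right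
    · rintro x ⟨hx, hx'⟩
      have heq : (fun i => Fin.append s s' i x) ∘ finSumFinEquiv
          = Sum.elim (fun i => s i x) fun i => s' i x := by
        ext i; rcases i with i | i <;> simp
      have hr : range (fun i => Fin.append s s' i x)
          = range (fun i => s i x) ∪ range fun i => s' i x := by
        rw [← finSumFinEquiv.surjective.range_comp, heq, Sum.elim_range]
      refine ⟨?_, ?_⟩
      · rw [← linearIndependent_equiv finSumFinEquiv, heq]
        refine (hfr x hx).1.sum_type (hfr' x hx').1 ?_
        rw [(hfr x hx).2, (hfr' x hx').2]
        exact h x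
      · rw [hr, Submodule.span_union, (hfr x hx).2, (hfr' x hx').2]

end Sections

/-! ### Orthogonal complements and intersections of subbundles -/

section Perp

variable {X : Type*} [TopologicalSpace X] [ChartedSpace ℂ X]
  {F : Type*} [NormedAddCommGroup F] [NormedSpace ℂ F]
  {W : X → Type*} [∀ x, AddCommGroup (W x)] [∀ x, Module ℂ (W x)] [∀ x, TopologicalSpace (W x)]
  [TopologicalSpace (TotalSpace F W)] [FiberBundle F W] [VectorBundle ℂ F W]
  {L : X → Type*} [∀ x, AddCommGroup (L x)] [∀ x, Module ℂ (L x)] [∀ x, TopologicalSpace (L x)]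
  [TopologicalSpace (TotalSpace ℂ L)] [FiberBundle ℂ L]

/-- The coordinate functionals on the span of `s` extend to `M` by a left inverse of the coordinate
map, and `Q` represents them by vectors. -/
theorem exists_dual_family {M : Type*} [AddCommGroup M] [Module ℂ M] [FiniteDimensional ℂ M]
    {Q : LinearMap.BilinForm ℂ M} (hQ : ∀ v w, Q v w = Q w v) (hn : Q.Nondegenerate)
    {ι : Type*} [Fintype ι] [DecidableEq ι] {s : ι → M} (hs : LinearIndependent ℂ s) :
    ∃ u : ι → M, (Matrix.of fun i j => Q (s i) (u j)) = 1 := by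
  obtain ⟨g, hg⟩ := LinearMap.exists_leftInverse_of_injective (Fintype.linearCombination ℂ s)
    (LinearMap.ker_eq_bot.2 hs.fintypeLinearCombination_injective)
  refine ⟨fun j => (Q.toDual hn).symm (LinearMap.proj j ∘ₗ g), ?_⟩
  ext i j
  have h1 := LinearMap.congr_fun hg (Pi.single i 1)
  simp only [LinearMap.comp_apply, Fintype.linearCombination_apply_single, one_smul,
    LinearMap.id_apply] at h1
  rw [Matrix.of_apply, hQ, LinearMap.BilinForm.apply_toDual_symm_apply, LinearMap.comp_apply,
    h1, LinearMap.proj_apply, Matrix.one_apply, Pi.single_apply, eq_comm]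
  simp [eq_comm]

variable [FiniteDimensional ℂ F] [ContMDiffVectorBundle ω F W 𝓘(ℂ)]

namespace OrthogonalPair

variable (P : OrthogonalPair F W L)

theorem finrank_perp (V : Subbundle F W) (x : X) :
    Module.finrank ℂ (P.perp V x) + Module.finrank ℂ (V.fiber x) = Module.finrank ℂ F := by
  have := finiteDimensional_fiber F W x
  have h1 := LinearMap.BilinForm.finrank_orthogonal (P.nondegenerate x) (V.fiber x)
  have h2 := Submodule.finrank_le (V.fiber x)
  rw [((trivializationAt F W x).linearEquivAt ℂ x
    (mem_baseSet_trivializationAt F W x)).finrank_eq] at h1 h2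
  rw [perp, h1]
  omega

/-- The holomorphic subbundle `V^{⊥_Q}`. -/
def perpBundle (V : Subbundle F W) : Subbundle F W :=
  Subbundle.mk' (P.perp V) fun x₀ => by
    obtain ⟨r, U, s, hU, hx₀, hs, hfr⟩ := V.exists_frame x₀
    obtain ⟨U', hU', hx₀', hext⟩ := exists_isHolOn_eq F (W := W) x₀
    choose ext hext hext₀ using hext
    have := finiteDimensional_fiber F W x₀
    obtain ⟨u₀, hu₀⟩ := exists_dual_family (P.symm x₀) (P.nondegenerate x₀) (hfr x₀ hx₀).1
    let u : Fin r → ∀ x, W x := fun j => ext (u₀ j)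
    let b := Module.finBasis ℂ (P.perp V x₀)
    let f : Fin _ → ∀ x, W x := fun j => ext (b j)
    let A : X → Matrix (Fin r) (Fin r) ℂ := fun x => Matrix.of fun i j => P.Q x (s i x) (u j x)
    let q : ∀ j, X → Fin r → ℂ := fun j x i => P.Q x (s i x) (f j x)
    -- Cramer's rule corrects `f j` to a section orthogonal to all `s i` without dividing by `det
    -- A`, so holomorphy is evident. At `x₀` the matrix `A` is the identity and `q j` vanishes, so
    -- `g j` still takes the value `b j`.
    let g : Fin (Module.finrank ℂ (P.perp V x₀)) → ∀ x, W x := fun j x =>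
      (A x).det • f j x - ∑ i, (A x).cramer (q j x) i • u i x
    have hUU : IsOpen (U ∩ U') := hU.inter hU'
    have hQs : ∀ (i : Fin r) (v : W x₀), ContMDiffOn 𝓘(ℂ) 𝓘(ℂ) ω
        (fun x => P.Q x (s i x) (ext v x)) (U ∩ U') := fun i v =>
      P.holomorphic_Q _ _ _ hUU ((hs i).mono inter_subset_left)
        ((hext v).mono inter_subset_right)
    have hg : ∀ j, IsHolOn F (g j) (U ∩ U') := by
      intro j
      refine IsHolOn.sub (IsHolOn.smul (contMDiffOn_det fun i i' => hQs _ _)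
        ((hext _).mono inter_subset_right)) (IsHolOn.sum fun i _ => IsHolOn.smul ?_
        ((hext _).mono inter_subset_right))
      simp only [Matrix.cramer_apply]
      refine contMDiffOn_det fun i' j' => ?_
      simp only [Matrix.updateCol_apply]
      split_ifs
      · exact hQs _ _
      · exact hQs _ _
    have hA : A x₀ = 1 := by
      rw [← hu₀]
      ext i j
      simp [A, u, hext₀]
    have hg₀ : ∀ j, g j x₀ = b j := by
      intro j
      have : q j x₀ = 0 := by
        ext i
        simp only [q, f, hext₀]
        exact (b j).2 _ ((hfr x₀ hx₀).2 ▸ Submodule.subset_span (mem_range_self i))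
      simp [g, hA, this, f, hext₀]
    refine ⟨_, U ∩ U', g, hUU, ⟨hx₀, hx₀'⟩, hg, ?_, fun x hx => ⟨fun j => ?_, ?_⟩⟩
    · simp only [hg₀]
      exact b.linearIndependent.map' _ (Submodule.ker_subtype _)
    · rw [perp, LinearMap.BilinForm.mem_orthogonal_iff, ← (hfr x hx.1).2]
      intro v hv
      suffices Submodule.span ℂ (range fun i => s i x) ≤ LinearMap.ker ((P.Q x).flip (g j x)) from
        this hv
      refine Submodule.span_le.2 (range_subset_iff.2 fun l => ?_)
      have h1 := congrFun (Matrix.mulVec_cramer (A x) (q j x)) l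
      simp only [Matrix.mulVec, dotProduct, Pi.smul_apply, smul_eq_mul] at h1
      change P.Q x (s l x) (g j x) = 0
      simp only [g, map_sub, map_smul, map_sum, smul_eq_mul, sub_eq_zero]
      refine h1.symm.trans ?_
      exact Finset.sum_congr rfl fun i _ => mul_comm _ _
    · have h1 := P.finrank_perp V x
      have h2 := P.finrank_perp V x₀
      rw [V.finrank_eq_of_frame (hfr x hx.1)] at h1
      rw [V.finrank_eq_of_frame (hfr x₀ hx₀)] at h2
      omega

theorem perpBundle_fiber (V : Subbundle F W) (x : X) :
    (P.perpBundle V).fiber x = P.perp V x := rfl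

theorem perp_perpBundle (V : Subbundle F W) (x : X) : P.perp (P.perpBundle V) x = V.fiber x :=
  haveI := finiteDimensional_fiber F W x
  orthogonal_orthogonal (P.symm x) (P.nondegenerate x) _

theorem orthogonal_sup_eq (x : X) (A B : Submodule ℂ (W x)) :
    (P.Q x).orthogonal (A ⊔ B) = (P.Q x).orthogonal A ⊓ (P.Q x).orthogonal B := by
  refine le_antisymm (le_inf (LinearMap.BilinForm.orthogonal_le le_sup_left)
    (LinearMap.BilinForm.orthogonal_le le_sup_right)) ?_
  rintro v ⟨hA, hB⟩ w hw
  obtain ⟨a, ha, b, hb, rfl⟩ := Submodule.mem_sup.1 hw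
  simpa [hA a ha] using hB b hb

theorem orthogonal_eq_bot_of_top (x : X) : (P.Q x).orthogonal ⊤ = ⊥ :=
  LinearMap.BilinForm.orthogonal_top_eq_bot (P.nondegenerate x)

/-- The intersection of two subbundles that span `W`. -/
theorem exists_inf (P : OrthogonalPair F W L) (V V' : Subbundle F W)
    (h : ∀ x, V.fiber x ⊔ V'.fiber x = ⊤) :
    ∃ V'' : Subbundle F W, ∀ x, V''.fiber x = V.fiber x ⊓ V'.fiber x := by
  -- The intersection is obtained as `(V^⊥ ⊕ V'^⊥)^⊥`; the inner sum is direct because `V` and `V'`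
  -- span `W`.
  have hd : ∀ x, Disjoint ((P.perpBundle V).fiber x) ((P.perpBundle V').fiber x) := by
    intro x
    rw [disjoint_iff, perpBundle_fiber, perpBundle_fiber, perp, perp, ← orthogonal_sup_eq, h,
      orthogonal_eq_bot_of_top]
  refine ⟨P.perpBundle ((P.perpBundle V).sup (P.perpBundle V') hd), fun x => ?_⟩
  have := (P.orthogonal_sup_eq x (P.perp V x) (P.perp V' x))
  refine this.trans ?_
  rw [← P.perp_perpBundle V x, ← P.perp_perpBundle V' x]
  rfl

end OrthogonalPair

end Perp
end HiggsPair
end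

noncomputable section

namespace HiggsPair

set_option linter.unusedSectionVars false

/-! ### The integral of a Laplacian over a compact Riemann surface -/

section Plane

open MeasureTheory Laplacian

theorem laplacian_apply (f : ℂ → ℝ) (z : ℂ) :
    laplacian f z = fderiv ℝ (fderiv ℝ f) z 1 1
      + fderiv ℝ (fderiv ℝ f) z Complex.I Complex.I := by
  rw [InnerProductSpace.laplacian_eq_iteratedFDeriv_complexPlane]
  simp [iteratedFDeriv_two_apply]

theorem contDiffAt_fderiv_fderiv {f : ℂ → ℝ} {z : ℂ} (hf : ContDiffAt ℝ ∞ f z) :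
    ContDiffAt ℝ ∞ (fderiv ℝ (fderiv ℝ f)) z :=
  (hf.fderiv_right (m := ∞) (by simp)).fderiv_right (m := ∞) (by simp)

theorem continuousAt_laplacian {f : ℂ → ℝ} {z : ℂ} (hf : ContDiffAt ℝ ∞ f z) :
    ContinuousAt (laplacian f) z := by
  have h := (contDiffAt_fderiv_fderiv hf).continuousAt
  simp only [funext (laplacian_apply f)]
  fun_prop

/-- The Laplacian of the composition with a holomorphic function. -/
theorem laplacian_comp_of_analyticAt {u : ℂ → ℝ} {φ : ℂ → ℂ} {z : ℂ} (hφ : AnalyticAt ℂ φ z)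
    (hu : ContDiffAt ℝ ∞ u (φ z)) :
    laplacian (u ∘ φ) z = Complex.normSq (deriv φ z) * laplacian u (φ z) := by
  have hder : ∀ w, AnalyticAt ℂ φ w → ∀ v, fderiv ℝ φ w v = v * deriv φ w := by
    intro w hw v
    rw [hw.differentiableAt.fderiv_restrictScalars ℝ]
    simp
  have hu2 : ∀ᶠ w in 𝓝 z, DifferentiableAt ℝ u (φ w) := by
    have h1 : ∀ᶠ y in 𝓝 (φ z), ContDiffAt ℝ 1 u y :=
      (hu.of_le (by norm_cast)).eventually (by simp)
    exact (hφ.continuousAt.eventually h1).mono fun w hw => hw.differentiableAt (by simp)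
  have h1 : ∀ᶠ w in 𝓝 z, ∀ v, fderiv ℝ (u ∘ φ) w v = fderiv ℝ u (φ w) (v * deriv φ w) := by
    filter_upwards [hu2, hφ.eventually_analyticAt] with w hw hw' v
    rw [fderiv_comp w hw (hw'.differentiableAt.restrictScalars ℝ), ContinuousLinearMap.comp_apply,
      hder w hw']
  have hDu : DifferentiableAt ℝ (fderiv ℝ u) (φ z) :=
    (hu.fderiv_right (m := ∞) (by simp)).differentiableAt (by simp)
  have hcomp : ContDiffAt ℝ ∞ (u ∘ φ) z := by
    refine ContDiffAt.comp z hu ?_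
    exact (hφ.contDiffAt (n := ∞)).restrict_scalars ℝ
  have hDc : DifferentiableAt ℝ (fderiv ℝ (u ∘ φ)) z :=
    (hcomp.fderiv_right (m := ∞) (by simp)).differentiableAt (by simp)
  have hφ' : HasFDerivAt (deriv φ) (fderiv ℝ (deriv φ) z) z :=
    (hφ.deriv.differentiableAt.restrictScalars ℝ).hasFDerivAt
  -- The chain rule for a second derivative, using that `φ` has complex linear derivative: a Hessian
  -- term and a term with `φ''`.
  have h2 : ∀ v, fderiv ℝ (fderiv ℝ (u ∘ φ)) z v v
      = fderiv ℝ (fderiv ℝ u) (φ z) (v * deriv φ z) (v * deriv φ z)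
        + fderiv ℝ u (φ z) (v * (v * deriv (deriv φ) z)) := by
    intro v
    have e1 : fderiv ℝ (fderiv ℝ (u ∘ φ)) z v v
        = fderiv ℝ (fun w => fderiv ℝ (u ∘ φ) w v) z v := by
      rw [fderiv_clm_apply hDc (differentiableAt_const v)]
      simp
    have e2 : (fun w => fderiv ℝ (u ∘ φ) w v) =ᶠ[𝓝 z]
        fun w => fderiv ℝ u (φ w) (v * deriv φ w) := h1.mono fun w hw => hw v
    have e3 : HasFDerivAt (fun w => fderiv ℝ u (φ w))
        ((fderiv ℝ (fderiv ℝ u) (φ z)).comp (fderiv ℝ φ z)) z :=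
      hDu.hasFDerivAt.comp z (hφ.differentiableAt.restrictScalars ℝ).hasFDerivAt
    have e4 := e3.clm_apply (hφ'.const_mul v)
    rw [e1, e2.fderiv_eq, e4.fderiv]
    have e5 : fderiv ℝ (deriv φ) z v = v * deriv (deriv φ) z := by
      rw [hφ.deriv.differentiableAt.fderiv_restrictScalars ℝ]
      simp
    simp [hder z hφ, e5, add_comm]
  rw [laplacian_apply, laplacian_apply, h2, h2]
  set B := fderiv ℝ (fderiv ℝ u) (φ z)
  -- The `φ''` terms for the directions `1` and `I` are opposite, since `I² = -1`.
  have hI : Complex.I * (Complex.I * deriv (deriv φ) z) = -(1 * (1 * deriv (deriv φ) z)) := by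
    rw [← mul_assoc, Complex.I_mul_I]; ring
  rw [hI, map_neg]
  generalize deriv φ z = a
  obtain ⟨p, q⟩ := a
  -- Multiplication by `a` is a similarity: in the sum of the two Hessian terms the mixed terms
  -- cancel and `p² + q²` factors out.
  have ha : (1 : ℂ) * ⟨p, q⟩ = p • (1 : ℂ) + q • Complex.I := by
    apply Complex.ext <;> simp
  have hb : Complex.I * ⟨p, q⟩ = (-q) • (1 : ℂ) + p • Complex.I := by
    apply Complex.ext <;> simp
  rw [ha, hb, Complex.normSq_mk]
  simp only [map_add, map_smul, add_apply, smul_apply, smul_eq_mul]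
  ring

/-- The integral of the Laplacian of a compactly supported function vanishes. -/
theorem integral_laplacian_eq_zero {f : ℂ → ℝ} (hf : ContDiff ℝ ∞ f) (hc : HasCompactSupport f) :
    ∫ z, laplacian f z = 0 := by
  have hf1 : ContDiff ℝ ∞ (fderiv ℝ f) := hf.fderiv_right (by simp)
  have hf2 : ContDiff ℝ ∞ (fderiv ℝ (fderiv ℝ f)) := hf1.fderiv_right (by simp)
  have key : ∀ v, Integrable (fun z => fderiv ℝ (fderiv ℝ f) z v v) ∧
      ∫ z, fderiv ℝ (fderiv ℝ f) z v v = 0 := by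
    intro v
    have hg : ContDiff ℝ ∞ (fun z => fderiv ℝ f z v) := hf1.clm_apply contDiff_const
    have hgc : HasCompactSupport (fun z => fderiv ℝ f z v) := hc.fderiv_apply (𝕜 := ℝ) v
    have e : ∀ z, fderiv ℝ (fun z => fderiv ℝ f z v) z v = fderiv ℝ (fderiv ℝ f) z v v := by
      intro z
      rw [fderiv_clm_apply (hf1.differentiable (by simp) z) (differentiableAt_const v)]
      simp
    have hi : Integrable (fun z => fderiv ℝ (fun z => fderiv ℝ f z v) z v) :=
      ((hg.fderiv_right (m := ∞) (by simp)).continuous.clm_apply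
        continuous_const).integrable_of_hasCompactSupport (hgc.fderiv_apply (𝕜 := ℝ) v)
    have hi' : Integrable (fun z => fderiv ℝ f z v) :=
      hg.continuous.integrable_of_hasCompactSupport hgc
    -- Integration by parts against the constant function `1`.
    have h := integral_mul_fderiv_eq_neg_fderiv_mul_of_integrable (μ := (volume : Measure ℂ))
      (f := fun _ => (1 : ℝ)) (g := fun z => fderiv ℝ f z v) (v := v)
      (by simp) (by simpa using hi) (by simpa using hi') (fun _ _ => differentiableAt_const _)
      (fun z _ => hg.differentiable (by simp) z)
    simp only [e] at hi h
    exact ⟨hi, by simpa using h⟩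
  simp only [laplacian_apply]
  rw [integral_add (key 1).1 (key _).1, (key 1).2, (key _).2, add_zero]

/-- The real determinant of multiplication by `a` is the norm of `a` from `ℂ` to `ℝ`. It equals the
factor by which the Laplacian changes under a holomorphic map with derivative `a`. -/
theorem abs_det_fderiv_of_analyticAt (a : ℂ) :
    |(((ContinuousLinearMap.toSpanSingleton ℂ a).restrictScalars ℝ : ℂ →L[ℝ] ℂ)).det|
      = Complex.normSq a := by
  have : (((ContinuousLinearMap.toSpanSingleton ℂ a).restrictScalars ℝ : ℂ →L[ℝ] ℂ)).det
      = Complex.normSq a := by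
    simp [ContinuousLinearMap.det, LinearMap.det_restrictScalars, Algebra.norm_complex_apply]
  rw [this, abs_of_nonneg (Complex.normSq_nonneg a)]

theorem integrableOn_of_continuousOn_of_forall_eq_zero {T K : Set ℂ} (hT : IsOpen T)
    (hK : IsCompact K) (hKT : K ⊆ T) {f : ℂ → ℝ} (hf : ContinuousOn f T)
    (h0 : ∀ z ∈ T, z ∉ K → f z = 0) : IntegrableOn f T :=
  ((hf.mono hKT).integrableOn_compact hK).of_forall_sdiff_eq_zero hT.measurableSet
    fun z hz => h0 z hz.1 hz.2

end Plane

/-! ### Change of charts and Stokes' theorem on the surface -/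

section Surface

open MeasureTheory Laplacian

variable {X : Type*} [TopologicalSpace X] [ChartedSpace ℂ X] [IsManifold 𝓘(ℂ) ω X]

theorem contDiffAt_comp_chart_symm {u : X → ℝ} {x : X}
    (hu : ContMDiffAt 𝓘(ℝ, ℂ) 𝓘(ℝ, ℝ) ∞ u x) {c : X} (hx : x ∈ (chartAt ℂ c).source) :
    ContDiffAt ℝ ∞ (u ∘ (chartAt ℂ c).symm) (chartAt ℂ c x) := by
  have := isManifold_real X
  rw [← contMDiffAt_iff_contDiffAt]
  have h := (contMDiffOn_chart_symm (I := 𝓘(ℝ, ℂ)) (n := ∞) (x := c)).contMDiffAt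
    ((chartAt ℂ c).open_target.mem_nhds ((chartAt ℂ c).map_source hx))
  refine ContMDiffAt.comp _ ?_ h
  rwa [(chartAt ℂ c).left_inv hx]

theorem analyticAt_comp_chart_symm {f : X → ℂ} {x : X}
    (hf : ContMDiffAt 𝓘(ℂ) 𝓘(ℂ) ω f x) {c : X} (hx : x ∈ (chartAt ℂ c).source) :
    AnalyticAt ℂ (f ∘ (chartAt ℂ c).symm) (chartAt ℂ c x) := by
  rw [← analyticWithinAt_univ, ← contDiffWithinAt_omega_iff_analyticWithinAt, contDiffWithinAt_univ,
    ← contMDiffAt_iff_contDiffAt]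
  have h := (contMDiffOn_chart_symm (I := 𝓘(ℂ)) (n := ω) (x := c)).contMDiffAt
    ((chartAt ℂ c).open_target.mem_nhds ((chartAt ℂ c).map_source hx))
  refine ContMDiffAt.comp _ ?_ h
  rwa [(chartAt ℂ c).left_inv hx]

/-- The Laplacian of `u` in the chart at `c`, at the point of `X` over `z`. -/
theorem laplacian_chart_eq {u : X → ℝ} (hu : ContMDiff 𝓘(ℝ, ℂ) 𝓘(ℝ, ℝ) ∞ u) {c d : X} {z : ℂ}
    (hz : z ∈ ((chartAt ℂ d).symm ≫ₕ chartAt ℂ c).source) :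
    laplacian (u ∘ (chartAt ℂ d).symm) z
      = Complex.normSq (deriv (chartAt ℂ c ∘ (chartAt ℂ d).symm) z) *
        laplacian (u ∘ (chartAt ℂ c).symm) (chartAt ℂ c ((chartAt ℂ d).symm z)) := by
  rw [OpenPartialHomeomorph.trans_source, OpenPartialHomeomorph.symm_source] at hz
  have hx := (chartAt ℂ d).map_target hz.1
  have hzz : chartAt ℂ d ((chartAt ℂ d).symm z) = z := (chartAt ℂ d).right_inv hz.1
  have hφ : AnalyticAt ℂ (chartAt ℂ c ∘ (chartAt ℂ d).symm) z := by
    have := analyticAt_comp_chart_symm ((contMDiffOn_chart (I := 𝓘(ℂ)) (n := ω) (x := c)).contMDiffAt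
      ((chartAt ℂ c).open_source.mem_nhds hz.2)) hx
    rwa [hzz] at this
  have h := laplacian_comp_of_analyticAt hφ (contDiffAt_comp_chart_symm hu.contMDiffAt hz.2)
  rw [Function.comp_apply] at h
  rw [← h]
  refine Filter.EventuallyEq.eq_of_nhds (InnerProductSpace.laplacian_congr_nhds ?_)
  filter_upwards [((chartAt ℂ d).symm ≫ₕ chartAt ℂ c).open_source.mem_nhds (x := z) (by
    rw [OpenPartialHomeomorph.trans_source, OpenPartialHomeomorph.symm_source]; exact hz)]
    with w hw
  rw [OpenPartialHomeomorph.trans_source, OpenPartialHomeomorph.symm_source] at hw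
  simp only [Function.comp_apply]
  rw [(chartAt ℂ c).left_inv hw.2]

/-- The integral of `ρ Δu dx ∧ dy` does not depend on the chart. -/
theorem integral_mul_laplacian_chart_eq {u ρ : X → ℝ} (hu : ContMDiff 𝓘(ℝ, ℂ) 𝓘(ℝ, ℝ) ∞ u)
    {c d : X} (hud : tsupport u ⊆ (chartAt ℂ d).source)
    (hρc : Function.support ρ ⊆ (chartAt ℂ c).source) :
    ∫ z in (chartAt ℂ c).target, ρ ((chartAt ℂ c).symm z) * laplacian (u ∘ (chartAt ℂ c).symm) z
      = ∫ z in (chartAt ℂ d).target,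
          ρ ((chartAt ℂ d).symm z) * laplacian (u ∘ (chartAt ℂ d).symm) z := by
  set A := (chartAt ℂ d).symm ≫ₕ chartAt ℂ c with hA
  have hAs : A.source = (chartAt ℂ d).target ∩ (chartAt ℂ d).symm ⁻¹' (chartAt ℂ c).source := by
    rw [hA, OpenPartialHomeomorph.trans_source, OpenPartialHomeomorph.symm_source]
  have hAt : A.target = (chartAt ℂ c).target ∩ (chartAt ℂ c).symm ⁻¹' (chartAt ℂ d).source := by
    rw [hA, OpenPartialHomeomorph.trans_target, OpenPartialHomeomorph.symm_target]
  -- Both integrals live on the overlap of the charts: in the chart at `c` because `u` vanishes near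
  -- every point outside the chart at `d`, in the chart at `d` because `ρ` vanishes outside the
  -- chart at `c`.
  have h1 : ∫ z in (chartAt ℂ c).target,
      ρ ((chartAt ℂ c).symm z) * laplacian (u ∘ (chartAt ℂ c).symm) z
      = ∫ z in A.target, ρ ((chartAt ℂ c).symm z) * laplacian (u ∘ (chartAt ℂ c).symm) z := by
    refine setIntegral_eq_of_subset_of_forall_sdiff_eq_zero (chartAt ℂ c).open_target.measurableSet
      (hAt ▸ inter_subset_left) fun z hz => ?_
    have hz' : (chartAt ℂ c).symm z ∉ tsupport u := fun h => hz.2 (hAt ▸ ⟨hz.1, hud h⟩)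
    have h0 : u ∘ (chartAt ℂ c).symm =ᶠ[𝓝 z] fun _ => 0 := by
      have hcont := (chartAt ℂ c).continuousAt_symm hz.1
      exact hcont.eventually (notMem_tsupport_iff_eventuallyEq.1 hz')
    rw [(InnerProductSpace.laplacian_congr_nhds h0).eq_of_nhds]
    simp
  have h2 : ∫ z in (chartAt ℂ d).target,
      ρ ((chartAt ℂ d).symm z) * laplacian (u ∘ (chartAt ℂ d).symm) z
      = ∫ z in A.source, ρ ((chartAt ℂ d).symm z) * laplacian (u ∘ (chartAt ℂ d).symm) z := by
    refine setIntegral_eq_of_subset_of_forall_sdiff_eq_zero (chartAt ℂ d).open_target.measurableSet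
      (hAs ▸ inter_subset_left) fun z hz => ?_
    have : ρ ((chartAt ℂ d).symm z) = 0 := by
      by_contra h
      exact hz.2 (hAs ▸ ⟨hz.1, hρc h⟩)
    rw [this, zero_mul]
  have hder : ∀ z ∈ A.source, HasFDerivWithinAt A
      ((ContinuousLinearMap.toSpanSingleton ℂ
        (deriv (chartAt ℂ c ∘ (chartAt ℂ d).symm) z)).restrictScalars ℝ) A.source z := by
    intro z hz
    have hz' := hAs ▸ hz
    have hφ : AnalyticAt ℂ (chartAt ℂ c ∘ (chartAt ℂ d).symm) z := by
      have := analyticAt_comp_chart_symm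
        ((contMDiffOn_chart (I := 𝓘(ℂ)) (n := ω) (x := c)).contMDiffAt
        ((chartAt ℂ c).open_source.mem_nhds hz'.2)) ((chartAt ℂ d).map_target hz'.1)
      rwa [(chartAt ℂ d).right_inv hz'.1] at this
    exact (hφ.differentiableAt.hasDerivAt.hasFDerivAt.restrictScalars ℝ).hasFDerivWithinAt
  rw [h1, h2, ← A.image_source_eq_target, integral_image_eq_integral_abs_det_fderiv_smul volume
    A.open_source.measurableSet hder A.injOn]
  refine setIntegral_congr_fun A.open_source.measurableSet fun z hz => ?_
  have hz' := hAs ▸ hz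
  simp only [abs_det_fderiv_of_analyticAt, smul_eq_mul]
  have e : A z = chartAt ℂ c ((chartAt ℂ d).symm z) := rfl
  -- The Jacobian of the transition map is exactly the conformal factor of the Laplacian.
  rw [laplacian_chart_eq hu hz, e, (chartAt ℂ c).left_inv hz'.2]
  ring

variable [T2Space X] [CompactSpace X]

variable (X) in
/-- The finitely many charts that meet the support of the partition of unity. -/
theorem exists_finset_partitionOfUnity : ∃ s : Finset X,
    (∀ c ∉ s, partitionOfUnity X c = 0) ∧ ∀ x, ∑ c ∈ s, partitionOfUnity X c x = 1 := by
  have hfin := (partitionOfUnity X).locallyFinite.finite_nonempty_of_compact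
  refine ⟨hfin.toFinset, fun c hc => ?_, fun x => ?_⟩
  · ext x
    by_contra h
    exact hc (hfin.mem_toFinset.2 ⟨x, h⟩)
  · rw [← (partitionOfUnity X).sum_eq_one (mem_univ x)]
    symm
    refine finsum_eq_sum_of_support_subset _ fun c hc => ?_
    exact hfin.mem_toFinset.2 ⟨x, hc⟩

/-- The products of `partitionOfUnity X c` with continuous functions on the chart are integrable. -/
theorem integrableOn_partitionOfUnity_mul (c : X) {f : ℂ → ℝ}
    (hf : ContinuousOn f (chartAt ℂ c).target) :
    IntegrableOn (fun z => partitionOfUnity X c ((chartAt ℂ c).symm z) * f z)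
      (chartAt ℂ c).target := by
  have hK : IsCompact (tsupport (partitionOfUnity X c)) := (isClosed_tsupport _).isCompact
  have hs := partitionOfUnity_isSubordinate (X := X) c
  refine integrableOn_of_continuousOn_of_forall_eq_zero (chartAt ℂ c).open_target
    (hK.image_of_continuousOn ((chartAt ℂ c).continuousOn.mono hs))
    (by rintro _ ⟨x, hx, rfl⟩; exact (chartAt ℂ c).map_source (hs hx)) ?_ fun z hz hzK => ?_
  · refine ContinuousOn.mul ?_ hf
    exact (partitionOfUnity X c).contMDiff.continuous.comp_continuousOn
      (chartAt ℂ c).continuousOn_symm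
  · rw [image_eq_zero_of_notMem_tsupport fun h => hzK ⟨_, h, (chartAt ℂ c).right_inv hz⟩, zero_mul]

/-- Extended by zero, `u` in the chart becomes a smooth compactly supported function on the plane,
because its support is compact inside the chart. -/
theorem integral_laplacian_chart_eq_zero {u : X → ℝ} (hu : ContMDiff 𝓘(ℝ, ℂ) 𝓘(ℝ, ℝ) ∞ u)
    {d : X} (hud : tsupport u ⊆ (chartAt ℂ d).source) :
    ∫ z in (chartAt ℂ d).target, laplacian (u ∘ (chartAt ℂ d).symm) z = 0 := by
  set T := (chartAt ℂ d).target
  let f : ℂ → ℝ := T.indicator (u ∘ (chartAt ℂ d).symm)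
  set K := chartAt ℂ d '' tsupport u
  have hK : IsCompact K := (isClosed_tsupport u).isCompact.image_of_continuousOn
    ((chartAt ℂ d).continuousOn.mono hud)
  have hKT : K ⊆ T := by
    rintro _ ⟨x, hx, rfl⟩
    exact (chartAt ℂ d).map_source (hud hx)
  have hTo : IsOpen T := (chartAt ℂ d).open_target
  have hfK : ∀ z ∉ K, f z = 0 := by
    intro z hz
    by_cases hzT : z ∈ T
    · rw [show f z = _ from indicator_of_mem hzT _, Function.comp_apply]
      exact image_eq_zero_of_notMem_tsupport fun h => hz ⟨_, h, (chartAt ℂ d).right_inv hzT⟩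
    · exact indicator_of_notMem hzT _
  have hfT : ∀ z ∈ T, f =ᶠ[𝓝 z] u ∘ (chartAt ℂ d).symm := fun z hz =>
    Filter.eventually_of_mem (hTo.mem_nhds hz) fun w hw => indicator_of_mem hw _
  have hf0 : ∀ z ∉ K, f =ᶠ[𝓝 z] fun _ => 0 := fun z hz =>
    Filter.eventually_of_mem (hK.isClosed.isOpen_compl.mem_nhds hz) fun w hw => hfK w hw
  have hf : ContDiff ℝ ∞ f := by
    rw [contDiff_iff_contDiffAt]
    intro z
    by_cases hz : z ∈ T
    · have := contDiffAt_comp_chart_symm (c := d) hu.contMDiffAt ((chartAt ℂ d).map_target hz)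
      rw [(chartAt ℂ d).right_inv hz] at this
      exact this.congr_of_eventuallyEq (hfT z hz)
    · exact contDiffAt_const.congr_of_eventuallyEq (hf0 z fun h => hz (hKT h))
  have hc : HasCompactSupport f := HasCompactSupport.intro hK hfK
  have h1 : ∫ z in T, laplacian f z = ∫ z, laplacian f z := by
    refine setIntegral_eq_integral_of_forall_compl_eq_zero fun z hz => ?_
    have h0 := (InnerProductSpace.laplacian_congr_nhds (hf0 z fun h => hz (hKT h))).eq_of_nhds
    rw [h0]
    simp
  rw [← integral_laplacian_eq_zero hf hc, ← h1]
  refine setIntegral_congr_fun hTo.measurableSet fun z hz => ?_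
  exact (InnerProductSpace.laplacian_congr_nhds (hfT z hz).symm).eq_of_nhds

theorem continuousOn_laplacian_chart {u : X → ℝ} (hu : ContMDiff 𝓘(ℝ, ℂ) 𝓘(ℝ, ℝ) ∞ u) (c : X) :
    ContinuousOn (laplacian (u ∘ (chartAt ℂ c).symm)) (chartAt ℂ c).target := by
  intro z hz
  have := contDiffAt_comp_chart_symm (c := c) hu.contMDiffAt ((chartAt ℂ c).map_target hz)
  rw [(chartAt ℂ c).right_inv hz] at this
  exact (continuousAt_laplacian this).continuousWithinAt

/-- **Stokes' theorem** for `∂∂̄u`: the integral of `Δu dx ∧ dy` over `X` vanishes. -/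
theorem finsum_integral_laplacian_eq_zero {g : X → ℝ} (hg : ContMDiff 𝓘(ℝ, ℂ) 𝓘(ℝ, ℝ) ∞ g) :
    ∑ᶠ c : X, ∫ z in (chartAt ℂ c).target,
      partitionOfUnity X c ((chartAt ℂ c).symm z) * laplacian (g ∘ (chartAt ℂ c).symm) z = 0 := by
  obtain ⟨s, hs0, hs1⟩ := exists_finset_partitionOfUnity X
  have hsub := partitionOfUnity_isSubordinate (X := X)
  -- `g` is the sum of the `u d`, each supported in a single chart.
  let u : X → X → ℝ := fun d x => partitionOfUnity X d x * g x
  have hu : ∀ d, ContMDiff 𝓘(ℝ, ℂ) 𝓘(ℝ, ℝ) ∞ (u d) := fun d =>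
    (contDiff_mul (𝕜 := ℝ) (𝔸 := ℝ)).comp_contMDiff
      (((partitionOfUnity X d).contMDiff.of_le le_rfl).prodMk_space hg)
  have hut : ∀ d, tsupport (u d) ⊆ (chartAt ℂ d).source := fun d =>
    (closure_mono (Function.support_mul_subset_left _ _)).trans (hsub d)
  have hgu : ∀ c : X, ∀ z ∈ (chartAt ℂ c).target, laplacian (g ∘ (chartAt ℂ c).symm) z
      = ∑ d ∈ s, laplacian (u d ∘ (chartAt ℂ c).symm) z := by
    intro c z hz
    have hc : ∀ d, ContDiffAt ℝ ∞ (u d ∘ (chartAt ℂ c).symm) z := by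
      intro d
      have := contDiffAt_comp_chart_symm (c := c) (hu d).contMDiffAt ((chartAt ℂ c).map_target hz)
      rwa [(chartAt ℂ c).right_inv hz] at this
    have hsum : g ∘ (chartAt ℂ c).symm = fun z => ∑ d ∈ s, (u d ∘ (chartAt ℂ c).symm) z := by
      ext z
      simp only [Function.comp_apply, u]
      rw [← Finset.sum_mul, hs1, one_mul]
    rw [hsum]
    clear hsum hs0 hs1
    induction s using Finset.cons_induction with
    | empty => simp
    | cons d s hd ih =>
      simp only [Finset.sum_cons]
      rw [← ih]
      exact ContDiffAt.laplacian_add ((hc d).of_le (by norm_cast))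
        ((ContDiffAt.sum fun i _ => hc i).of_le (by norm_cast))
  rw [finsum_eq_sum_of_support_subset (s := s)]
  -- The contribution of `u d` is moved from the chart at `c` to the one at `d`, where the terms for
  -- different `c` can be added.
  · have e1 : ∀ c ∈ s, ∫ z in (chartAt ℂ c).target,
        partitionOfUnity X c ((chartAt ℂ c).symm z) * laplacian (g ∘ (chartAt ℂ c).symm) z
        = ∑ d ∈ s, ∫ z in (chartAt ℂ d).target,
          partitionOfUnity X c ((chartAt ℂ d).symm z) *
            laplacian (u d ∘ (chartAt ℂ d).symm) z := by
      intro c _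
      rw [setIntegral_congr_fun (chartAt ℂ c).open_target.measurableSet
        (g := fun z => ∑ d ∈ s, partitionOfUnity X c ((chartAt ℂ c).symm z) *
            laplacian (u d ∘ (chartAt ℂ c).symm) z)
        (fun z hz => by simp only; rw [hgu c z hz, Finset.mul_sum]),
        integral_finsetSum]
      · refine Finset.sum_congr rfl fun d _ => ?_
        exact integral_mul_laplacian_chart_eq (hu d) (hut d) ((subset_tsupport _).trans (hsub c))
      · intro d _
        exact integrableOn_partitionOfUnity_mul c (continuousOn_laplacian_chart (hu d) c)
    rw [Finset.sum_congr rfl e1, Finset.sum_comm]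
    -- In the chart at `d` the weights `partitionOfUnity X c` add up to `1`, leaving the integral of
    -- the Laplacian of `u d` alone.
    refine Finset.sum_eq_zero fun d _ => ?_
    rw [← integral_finsetSum]
    · rw [← integral_laplacian_chart_eq_zero (hu d) (hut d)]
      refine setIntegral_congr_fun (chartAt ℂ d).open_target.measurableSet fun z hz => ?_
      rw [← Finset.sum_mul, hs1, one_mul]
    · intro c _
      set K := chartAt ℂ d '' tsupport (u d)
      have hK : IsCompact K := (isClosed_tsupport (u d)).isCompact.image_of_continuousOn
        ((chartAt ℂ d).continuousOn.mono (hut d))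
      refine integrableOn_of_continuousOn_of_forall_eq_zero (chartAt ℂ d).open_target hK
        (by rintro _ ⟨x, hx, rfl⟩; exact (chartAt ℂ d).map_source (hut d hx)) ?_ fun z hz hzK => ?_
      · exact ((partitionOfUnity X c).contMDiff.continuous.comp_continuousOn
          (chartAt ℂ d).continuousOn_symm).mul (continuousOn_laplacian_chart (hu d) d)
      · have h0 : u d ∘ (chartAt ℂ d).symm =ᶠ[𝓝 z] fun _ => 0 := by
          have hz' : (chartAt ℂ d).symm z ∉ tsupport (u d) := fun h =>
            hzK ⟨_, h, (chartAt ℂ d).right_inv hz⟩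
          exact ((chartAt ℂ d).continuousAt_symm hz).eventually
            (notMem_tsupport_iff_eventuallyEq.1 hz')
        rw [(InnerProductSpace.laplacian_congr_nhds h0).eq_of_nhds]
        simp
  · intro c hc
    by_contra h
    exact hc (by simp [hs0 c h])

end Surface
end HiggsPair
end

noncomputable section

namespace HiggsPair

/-! ### Determinants of bilinear and Hermitian forms in bases -/

section PairingMatrices

variable {M : Type*} [AddCommGroup M] [Module ℂ M]

/-- The matrix `Q(sᵢ, uⱼ)`. -/
def pairMatrix (Q : LinearMap.BilinForm ℂ M) {ι κ : Type*} (s : ι → M) (u : κ → M) :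
    Matrix ι κ ℂ :=
  Matrix.of fun i j => Q (s i) (u j)

/-- The real part of the Gram determinant of `s`. -/
def gram (h : M →ₗ⋆[ℂ] M →ₗ[ℂ] ℂ) {ι : Type*} [Fintype ι] [DecidableEq ι] (s : ι → M) : ℝ :=
  (Matrix.of fun i j => h (s i) (s j)).det.re

/-- The families `s`, `t` are bases of `V` and of `V^{⊥_Q}`, and `u` is a basis of a complement of
`V^{⊥_Q}`. -/
structure IsAdapted (Q : LinearMap.BilinForm ℂ M) (V : Submodule ℂ M) {ι κ : Type*} [Fintype ι]
    [DecidableEq ι] (s : ι → M) (t : κ → M) (u : ι → M) : Prop where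
  left : LinearIndependent ℂ s
  span_left : Submodule.span ℂ (range s) = V
  right : LinearIndependent ℂ t
  span_right : Submodule.span ℂ (range t) = Q.orthogonal V
  det_ne_zero : (pairMatrix Q s u).det ≠ 0

/-- The logarithm of the quotient of the Gram determinants of `V^{⊥_Q}` and `V`, corrected to be
independent of the choice of adapted bases. -/
def logRatio (Q : LinearMap.BilinForm ℂ M) (h : M →ₗ⋆[ℂ] M →ₗ[ℂ] ℂ) {ι κ : Type*} [Fintype ι]
    [DecidableEq ι] [Fintype κ] [DecidableEq κ] (s : ι → M) (t : κ → M) (u : ι → M) : ℝ :=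
  Real.log (gram h t) - Real.log (gram h s) + 2 * Real.log ‖(pairMatrix Q s u).det‖
    - Real.log ‖(pairMatrix Q (Sum.elim t u) (Sum.elim t u)).det‖

variable {Q : LinearMap.BilinForm ℂ M} {h : M →ₗ⋆[ℂ] M →ₗ[ℂ] ℂ}

theorem pairMatrix_sum_left {ι ι' κ : Type*} [Fintype ι] (B : Matrix ι' ι ℂ) (s : ι → M)
    (u : κ → M) : pairMatrix Q (fun i => ∑ j, B i j • s j) u = B * pairMatrix Q s u := by
  ext i j
  simp [pairMatrix, Matrix.mul_apply, LinearMap.sum_apply]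

theorem pairMatrix_sum_right {ι κ κ' : Type*} [Fintype κ] (C : Matrix κ' κ ℂ) (s : ι → M)
    (u : κ → M) :
    pairMatrix Q s (fun i => ∑ j, C i j • u j) = pairMatrix Q s u * C.transpose := by
  ext i j
  simp [pairMatrix, Matrix.mul_apply, mul_comm]

theorem gram_sum {ι : Type*} [Fintype ι] [DecidableEq ι] (B : Matrix ι ι ℂ) (s : ι → M) :
    gram h (fun i => ∑ j, B i j • s j) = ‖B.det‖ ^ 2 * gram h s := by
  have e : (Matrix.of fun i i' => h (∑ j, B i j • s j) (∑ j, B i' j • s j))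
      = B.map (starRingEnd ℂ) * (Matrix.of fun i j => h (s i) (s j)) * B.transpose := by
    ext i i'
    simp only [map_sum, Matrix.of_apply, LinearMap.sum_apply, Matrix.mul_apply, Matrix.map_apply,
      Matrix.transpose_apply, Finset.sum_mul, LinearMap.map_smulₛₗ, LinearMap.smul_apply,
      smul_eq_mul, map_smul, Finset.mul_sum]
    refine Finset.sum_congr rfl fun j _ => Finset.sum_congr rfl fun k _ => ?_
    ring
  have e2 : (B.map (starRingEnd ℂ)).det = starRingEnd ℂ B.det := (RingHom.map_det _ _).symm
  rw [gram, e, Matrix.det_mul, Matrix.det_mul, Matrix.det_transpose, e2, gram, mul_right_comm,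
    mul_comm (starRingEnd ℂ _), Complex.mul_conj, Complex.re_ofReal_mul, Complex.normSq_eq_norm_sq]

open scoped ComplexOrder in
theorem gram_pos (hsymm : ∀ v w, (starRingEnd ℂ) (h v w) = h w v)
    (hpos : ∀ v, v ≠ 0 → 0 < (h v v).re) {ι : Type*} [Fintype ι] [DecidableEq ι] {s : ι → M}
    (hs : LinearIndependent ℂ s) : 0 < gram h s := by
  have hP : (Matrix.of fun i j => h (s i) (s j)).PosDef := by
    refine Matrix.PosDef.of_dotProduct_mulVec_pos ?_ fun x hx => ?_
    · ext i j
      simp only [Matrix.conjTranspose_apply, Matrix.of_apply]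
      exact hsymm _ _
    · have e : star x ⬝ᵥ (Matrix.of fun i j => h (s i) (s j)).mulVec x
          = h (∑ i, x i • s i) (∑ i, x i • s i) := by
        simp only [map_sum, LinearMap.sum_apply, LinearMap.map_smulₛₗ, LinearMap.smul_apply,
          smul_eq_mul, dotProduct, Matrix.mulVec, Matrix.of_apply, Pi.star_apply, Finset.mul_sum]
        rw [Finset.sum_comm]
        refine Finset.sum_congr rfl fun j _ => Finset.sum_congr rfl fun k _ => ?_
        simp
        ring
      have hv : ∑ i, x i • s i ≠ 0 := fun h0 =>
        hx (funext fun i => Fintype.linearIndependent_iff.1 hs x h0 i)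
      rw [e, Complex.lt_def]
      refine ⟨by simpa using hpos _ hv, ?_⟩
      have := congrArg Complex.im (hsymm (∑ i, x i • s i) (∑ i, x i • s i))
      simp only [Complex.conj_im] at this
      simp only [Complex.zero_im]
      linarith
  have := hP.det_pos
  rw [Complex.lt_def] at this
  simpa [gram] using this.1

theorem exists_matrix_of_span_le {ι ι' : Type*} [Fintype ι] {s : ι → M} {s' : ι' → M}
    (hs : ∀ i, s' i ∈ Submodule.span ℂ (range s)) :
    ∃ B : Matrix ι' ι ℂ, s' = fun i => ∑ j, B i j • s j := by
  simp only [Submodule.mem_span_range_iff_exists_fun] at hs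
  choose B hB using hs
  exact ⟨Matrix.of B, funext fun i => (hB i).symm⟩

/-- As `Q(sᵢ, uⱼ)` is invertible, some combination of the `u i` has the same pairings with `V` as
`v`; the difference lies in `V^⊥`, the span of `t`. -/
theorem IsAdapted.span_elim {V : Submodule ℂ M} {ι κ : Type*} [Fintype ι] [DecidableEq ι]
    [Fintype κ] {s : ι → M} {t : κ → M} {u : ι → M} (hA : IsAdapted Q V s t u) (v : M) :
    v ∈ Submodule.span ℂ (range (Sum.elim t u)) := by
  let A := pairMatrix Q s u
  let c := A⁻¹.mulVec fun i => Q (s i) v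
  have hc : A.mulVec c = fun i => Q (s i) v := by
    rw [Matrix.mulVec_mulVec, Matrix.mul_nonsing_inv _ (isUnit_iff_ne_zero.2 hA.det_ne_zero),
      Matrix.one_mulVec]
  have h1 : v - ∑ i, c i • u i ∈ Submodule.span ℂ (range t) := by
    rw [hA.span_right, ← hA.span_left]
    intro w hw
    suffices Submodule.span ℂ (range s) ≤ LinearMap.ker (Q.flip (v - ∑ i, c i • u i)) from this hw
    refine Submodule.span_le.2 (range_subset_iff.2 fun l => ?_)
    have h2 := congrFun hc l
    change Q (s l) (v - ∑ i, c i • u i) = 0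
    simp only [map_sub, map_sum, map_smul, smul_eq_mul, ← h2, Matrix.mulVec, dotProduct,
      sub_eq_zero]
    exact Finset.sum_congr rfl fun i _ => mul_comm _ _
  rw [← sub_add_cancel v (∑ i, c i • u i), Sum.elim_range, Submodule.span_union]
  refine Submodule.add_mem_sup h1 (Submodule.sum_mem _ fun i _ => Submodule.smul_mem _ _
    (Submodule.subset_span (mem_range_self i)))

/-- Pairing a relation with the `s i` kills the `t j`, so the invertible matrix `Q(sᵢ, uⱼ)`
annihilates the coefficients of `u`. -/
theorem IsAdapted.linearIndependent_elim {V : Submodule ℂ M} {ι κ : Type*} [Fintype ι]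
    [DecidableEq ι] [Fintype κ] {s : ι → M} {t : κ → M} {u : ι → M} (hA : IsAdapted Q V s t u) :
    LinearIndependent ℂ (Sum.elim t u) := by
  rw [Fintype.linearIndependent_iff]
  intro g hg
  simp only [Fintype.sum_sum_type, Sum.elim_inl, Sum.elim_inr] at hg
  have hst : ∀ i j, Q (s i) (t j) = 0 := fun i j => by
    have : t j ∈ Q.orthogonal V := hA.span_right ▸ Submodule.subset_span (mem_range_self j)
    exact this _ (hA.span_left ▸ Submodule.subset_span (mem_range_self i))
  have h1 : (pairMatrix Q s u).mulVec (fun i => g (Sum.inr i)) = 0 := by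
    ext i
    have := congrArg (Q (s i)) hg
    simpa [hst, Matrix.mulVec, dotProduct, pairMatrix, mul_comm] using this
  have h2 := Matrix.eq_zero_of_mulVec_eq_zero hA.det_ne_zero h1
  have h3 : ∀ i, g (Sum.inr i) = 0 := fun i => congrFun h2 i
  simp only [h3, zero_smul, Finset.sum_const_zero, add_zero] at hg
  rintro (i | i)
  · exact Fintype.linearIndependent_iff.1 hA.right _ hg i
  · exact h3 i

theorem IsAdapted.det_elim_ne_zero (hn : Q.Nondegenerate) {V : Submodule ℂ M} {ι κ : Type*}
    [Fintype ι] [DecidableEq ι] [Fintype κ] [DecidableEq κ] {s : ι → M} {t : κ → M} {u : ι → M}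
    (hA : IsAdapted Q V s t u) :
    (pairMatrix Q (Sum.elim t u) (Sum.elim t u)).det ≠ 0 := by
  let b := Module.Basis.mk hA.linearIndependent_elim fun v _ => hA.span_elim v
  have := (LinearMap.BilinForm.nondegenerate_iff_det_ne_zero b).1 hn
  convert this using 3
  ext i j
  simp [pairMatrix, b, LinearMap.BilinForm.toMatrix_apply]

/-- Let `B`, `A`, `C` be the transition matrices for `V`, `V^⊥`, `M / V^⊥`. The four terms change by
`2 log |A|`, `-2 log |B|`, `2 log |B| + 2 log |C|` and `-2 log |A| - 2 log |C|` (with `|·|` the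
absolute value of the determinant), which add up to zero. -/
theorem logRatio_eq_of_isAdapted (hn : Q.Nondegenerate)
    (hsymm : ∀ v w, (starRingEnd ℂ) (h v w) = h w v) (hpos : ∀ v, v ≠ 0 → 0 < (h v v).re)
    {V : Submodule ℂ M} {r m r' m' : ℕ} {s u : Fin r → M} {t : Fin m → M} {s' u' : Fin r' → M}
    {t' : Fin m' → M} (hA : IsAdapted Q V s t u) (hA' : IsAdapted Q V s' t' u') :
    logRatio Q h s' t' u' = logRatio Q h s t u := by
  obtain rfl : r = r' := by
    rw [← Fintype.card_fin r, ← Fintype.card_fin r', ← finrank_span_eq_card hA.left,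
      ← finrank_span_eq_card hA'.left, hA.span_left, hA'.span_left]
  obtain rfl : m = m' := by
    rw [← Fintype.card_fin m, ← Fintype.card_fin m', ← finrank_span_eq_card hA.right,
      ← finrank_span_eq_card hA'.right, hA.span_right, hA'.span_right]
  obtain ⟨B, hB⟩ := exists_matrix_of_span_le (s := s) (s' := s') fun i =>
    (hA'.span_left.trans hA.span_left.symm) ▸ Submodule.subset_span (mem_range_self i)
  obtain ⟨A, hA₁⟩ := exists_matrix_of_span_le (s := t) (s' := t') fun i =>
    (hA'.span_right.trans hA.span_right.symm) ▸ Submodule.subset_span (mem_range_self i)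
  obtain ⟨D, hD⟩ := exists_matrix_of_span_le (s := Sum.elim t u) (s' := u') fun i =>
    hA.span_elim _
  let C : Matrix (Fin r) (Fin r) ℂ := D.submatrix id Sum.inr
  -- The transition matrix of the whole basis is block triangular, because `t'` and `t` both span
  -- `V^⊥`.
  let T : Matrix (Fin m ⊕ Fin r) (Fin m ⊕ Fin r) ℂ :=
    Matrix.fromBlocks A 0 (D.submatrix id Sum.inl) C
  have hT : Sum.elim t' u' = fun i => ∑ j, T i j • Sum.elim t u j := by
    ext i
    rcases i with i | i
    · simp [T, hA₁]
    · simp [T, hD, C]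
  have hst : pairMatrix Q s t = 0 := by
    ext i j
    have : t j ∈ Q.orthogonal V := hA.span_right ▸ Submodule.subset_span (mem_range_self j)
    exact this _ (hA.span_left ▸ Submodule.subset_span (mem_range_self i))
  -- Only the block `C` enters here: the `t`-components of `u'` are orthogonal to `V`.
  have e1 : pairMatrix Q s' u' = B * (pairMatrix Q s u * C.transpose) := by
    rw [hB, pairMatrix_sum_left, hD, pairMatrix_sum_right]
    congr 1
    ext i j
    have : ∀ x, Q (s i) (t x) = 0 := fun x => congrFun (congrFun hst i) x
    simp [Matrix.mul_apply, pairMatrix, C, this]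
  have e2 : pairMatrix Q (Sum.elim t' u') (Sum.elim t' u')
      = T * (pairMatrix Q (Sum.elim t u) (Sum.elim t u) * T.transpose) := by
    rw [hT, pairMatrix_sum_left, pairMatrix_sum_right]
  have e3 : T.det = A.det * C.det := Matrix.det_fromBlocks_zero₁₂ _ _ _
  have gs : gram h s' = ‖B.det‖ ^ 2 * gram h s := by rw [hB, gram_sum]
  have gt : gram h t' = ‖A.det‖ ^ 2 * gram h t := by rw [hA₁, gram_sum]
  have pt' := gram_pos hsymm hpos hA'.right
  have pt := gram_pos hsymm hpos hA.right
  have ps := gram_pos hsymm hpos hA.left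
  have d1 := hA'.det_ne_zero
  rw [e1, Matrix.det_mul, Matrix.det_mul, Matrix.det_transpose] at d1
  have nA : ‖A.det‖ ≠ 0 := fun h0 => by
    rw [gt, h0] at pt'; simp at pt'
  have nB : ‖B.det‖ ≠ 0 := norm_ne_zero_iff.2 (left_ne_zero_of_mul d1)
  have nC : ‖C.det‖ ≠ 0 := norm_ne_zero_iff.2 (right_ne_zero_of_mul (right_ne_zero_of_mul d1))
  have nM : ‖(pairMatrix Q s u).det‖ ≠ 0 := norm_ne_zero_iff.2 hA.det_ne_zero
  have nD : ‖(pairMatrix Q (Sum.elim t u) (Sum.elim t u)).det‖ ≠ 0 :=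
    norm_ne_zero_iff.2 (hA.det_elim_ne_zero hn)
  rw [logRatio, logRatio, e1, e2, gs, gt]
  simp only [Matrix.det_mul, Matrix.det_transpose, norm_mul, e3]
  rw [Real.log_mul (pow_ne_zero 2 nA) pt.ne', Real.log_mul (pow_ne_zero 2 nB) ps.ne',
    Real.log_mul nB (mul_ne_zero nM nC), Real.log_mul nM nC,
    Real.log_mul (mul_ne_zero nA nC) (mul_ne_zero nD (mul_ne_zero nA nC)),
    Real.log_mul nD (mul_ne_zero nA nC), Real.log_mul nA nC, Real.log_pow, Real.log_pow]
  push_cast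
  ring

theorem exists_isAdapted [FiniteDimensional ℂ M] (hQ : ∀ v w, Q v w = Q w v)
    (hn : Q.Nondegenerate) {V : Submodule ℂ M} {r m : ℕ} {s : Fin r → M} {t : Fin m → M}
    (hs : LinearIndependent ℂ s) (hsV : Submodule.span ℂ (range s) = V)
    (ht : LinearIndependent ℂ t) (htV : Submodule.span ℂ (range t) = Q.orthogonal V) :
    ∃ u, IsAdapted Q V s t u := by
  obtain ⟨u, hu⟩ := exists_dual_family hQ hn hs
  refine ⟨u, hs, hsV, ht, htV, ?_⟩
  rw [pairMatrix, hu, Matrix.det_one]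
  exact one_ne_zero

end PairingMatrices
end HiggsPair
end

noncomputable section

namespace HiggsPair

set_option linter.unusedSectionVars false

/-! ### The degree of `V^{⊥_Q}` -/

section ChartLaplacian

open Laplacian

variable {X : Type*} [TopologicalSpace X] [ChartedSpace ℂ X] [IsManifold 𝓘(ℂ) ω X]

theorem contMDiffAt_log_norm {f : X → ℂ} {x : X} (hf : ContMDiffAt 𝓘(ℂ) 𝓘(ℂ) ω f x)
    (h0 : f x ≠ 0) : ContMDiffAt 𝓘(ℝ, ℂ) 𝓘(ℝ, ℝ) ∞ (fun x => Real.log ‖f x‖) x := by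
  have h : ContDiffAt ℝ ∞ (fun z : ℂ => Real.log ‖z‖) (f x) :=
    (contDiffAt_id.norm ℝ h0).log (norm_ne_zero_iff.2 h0)
  exact h.contMDiffAt.comp x (contMDiffAt_real hf)

theorem laplacian_log_norm {f : X → ℂ} {x : X} (hf : ContMDiffAt 𝓘(ℂ) 𝓘(ℂ) ω f x)
    (h0 : f x ≠ 0) {c : X} (hx : x ∈ (chartAt ℂ c).source) :
    laplacian ((fun x => Real.log ‖f x‖) ∘ (chartAt ℂ c).symm) (chartAt ℂ c x) = 0 := by
  have h := (analyticAt_comp_chart_symm hf hx).harmonicAt_log_norm (by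
    rwa [Function.comp_apply, (chartAt ℂ c).left_inv hx])
  exact h.2.eq_of_nhds

theorem laplacian_chart_congr {a b : X → ℝ} {c x : X} (hx : x ∈ (chartAt ℂ c).source)
    (h : a =ᶠ[𝓝 x] b) : laplacian (a ∘ (chartAt ℂ c).symm) (chartAt ℂ c x)
      = laplacian (b ∘ (chartAt ℂ c).symm) (chartAt ℂ c x) := by
  refine (InnerProductSpace.laplacian_congr_nhds ?_).eq_of_nhds
  have hc := (chartAt ℂ c).continuousAt_symm ((chartAt ℂ c).map_source hx)
  rw [ContinuousAt, (chartAt ℂ c).left_inv hx] at hc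
  exact hc.eventually h

theorem laplacian_chart_add {a b : X → ℝ} {x : X} (ha : ContMDiffAt 𝓘(ℝ, ℂ) 𝓘(ℝ, ℝ) ∞ a x)
    (hb : ContMDiffAt 𝓘(ℝ, ℂ) 𝓘(ℝ, ℝ) ∞ b x) {c : X} (hx : x ∈ (chartAt ℂ c).source) :
    laplacian ((a + b) ∘ (chartAt ℂ c).symm) (chartAt ℂ c x)
      = laplacian (a ∘ (chartAt ℂ c).symm) (chartAt ℂ c x)
        + laplacian (b ∘ (chartAt ℂ c).symm) (chartAt ℂ c x) :=
  ContDiffAt.laplacian_add ((contDiffAt_comp_chart_symm ha hx).of_le (by norm_cast))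
    ((contDiffAt_comp_chart_symm hb hx).of_le (by norm_cast))

theorem laplacian_chart_smul (v : ℝ) {a : X → ℝ} {x : X}
    (ha : ContMDiffAt 𝓘(ℝ, ℂ) 𝓘(ℝ, ℝ) ∞ a x) {c : X} (hx : x ∈ (chartAt ℂ c).source) :
    laplacian ((v • a) ∘ (chartAt ℂ c).symm) (chartAt ℂ c x)
      = v * laplacian (a ∘ (chartAt ℂ c).symm) (chartAt ℂ c x) :=
  InnerProductSpace.laplacian_smul v ((contDiffAt_comp_chart_symm ha hx).of_le (by norm_cast))

end ChartLaplacian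

/-! ### Comparison of the Chern forms of `V` and `V^⊥` -/

section Degree

open Laplacian MeasureTheory

variable {X : Type*} [TopologicalSpace X] [ChartedSpace ℂ X] [IsManifold 𝓘(ℂ) ω X]
  {F : Type*} [NormedAddCommGroup F] [NormedSpace ℂ F] [FiniteDimensional ℂ F]
  {W : X → Type*} [∀ x, AddCommGroup (W x)] [∀ x, Module ℂ (W x)] [∀ x, TopologicalSpace (W x)]
  [TopologicalSpace (TotalSpace F W)] [FiberBundle F W] [VectorBundle ℂ F W]
  [ContMDiffVectorBundle ω F W 𝓘(ℂ)]
  {L : X → Type*} [∀ x, AddCommGroup (L x)] [∀ x, Module ℂ (L x)] [∀ x, TopologicalSpace (L x)]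
  [TopologicalSpace (TotalSpace ℂ L)] [FiberBundle ℂ L]

/-- The sections `s` form a holomorphic frame of `V` on `U`. -/
structure Subbundle.IsFrame (V : Subbundle F W) {r : ℕ} (s : Fin r → ∀ x, W x) (U : Set X) :
    Prop where
  isOpen : IsOpen U
  isHolOn : ∀ i, IsHolOn F (s i) U
  linearIndependent : ∀ x ∈ U, LinearIndependent ℂ fun i => s i x
  span_eq : ∀ x ∈ U, Submodule.span ℂ (range fun i => s i x) = V.fiber x

theorem Subbundle.exists_isFrame (V : Subbundle F W) (x : X) :
    ∃ U, x ∈ U ∧ V.IsFrame (V.frame x) U := by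
  obtain ⟨hU, hx, hs, hfr⟩ := (V.exists_frame x).choose_spec.choose_spec.choose_spec
  exact ⟨_, hx, hU, hs, fun y hy => (hfr y hy).1, fun y hy => (hfr y hy).2⟩

theorem HermitianMetric.gramDet_pos (h : HermitianMetric F W) {V : Subbundle F W} {r : ℕ}
    {s : Fin r → ∀ x, W x} {U : Set X} (hs : V.IsFrame s U) {x : X} (hx : x ∈ U) :
    0 < h.gramDet s x :=
  gram_pos (h.conj_symm x) (h.pos x) (hs.linearIndependent x hx)

theorem HermitianMetric.contMDiffAt_log_gramDet (h : HermitianMetric F W) {V : Subbundle F W}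
    {r : ℕ} {s : Fin r → ∀ x, W x} {U : Set X} (hs : V.IsFrame s U) {x : X} (hx : x ∈ U) :
    ContMDiffAt 𝓘(ℝ, ℂ) 𝓘(ℝ, ℝ) ∞ (fun x => Real.log (h.gramDet s x)) x := by
  have h1 := (contMDiffOn_det_real (U := U)
    (A := fun x => Matrix.of fun i j => h.form x (s i x) (s j x)) fun i j =>
      h.smooth U _ _ hs.isOpen (hs.isHolOn i) (hs.isHolOn j)).contMDiffAt (hs.isOpen.mem_nhds hx)
  have h2 : ContDiffAt ℝ ∞ (fun z : ℂ => Real.log z.re)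
      (Matrix.of fun i j => h.form x (s i x) (s j x)).det :=
    Complex.reCLM.contDiff.contDiffAt.log (h.gramDet_pos hs hx).ne'
  exact h2.contMDiffAt.comp x h1

variable (P : OrthogonalPair F W L)

theorem OrthogonalPair.contMDiffAt_det_pairMatrix {ι : Type*} [Fintype ι] [DecidableEq ι]
    {s u : ι → ∀ x, W x} {U : Set X} (hU : IsOpen U) (hs : ∀ i, IsHolOn F (s i) U)
    (hu : ∀ i, IsHolOn F (u i) U) {x : X} (hx : x ∈ U) :
    ContMDiffAt 𝓘(ℂ) 𝓘(ℂ) ω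
      (fun x => (pairMatrix (P.Q x) (fun i => s i x) fun i => u i x).det) x :=
  (contMDiffOn_det fun i j => P.holomorphic_Q U _ _ hU (hs i) (hu j)).contMDiffAt
    (hU.mem_nhds hx)

/-- Frames of `V` and of `V^{⊥_Q}` are locally completed to adapted frames. -/
theorem OrthogonalPair.exists_isAdapted_nhds {V : Subbundle F W} {r m : ℕ}
    {s : Fin r → ∀ x, W x} {t : Fin m → ∀ x, W x} {U U' : Set X} (hs : V.IsFrame s U)
    (ht : (P.perpBundle V).IsFrame t U') {x : X} (hx : x ∈ U) (hx' : x ∈ U') :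
    ∃ (u : Fin r → ∀ x, W x) (U'' : Set X), IsOpen U'' ∧ x ∈ U'' ∧ U'' ⊆ U ∧ U'' ⊆ U' ∧
      (∀ i, IsHolOn F (u i) U'') ∧ ∀ y ∈ U'',
        IsAdapted (P.Q y) (V.fiber y) (fun i => s i y) (fun i => t i y) fun i => u i y := by
  have := finiteDimensional_fiber F W x
  obtain ⟨u₀, hu₀⟩ := exists_isAdapted (P.symm x) (P.nondegenerate x) (hs.linearIndependent x hx)
    (hs.span_eq x hx) (ht.linearIndependent x hx') (ht.span_eq x hx')
  obtain ⟨U₁, hU₁, hx₁, hext⟩ := exists_isHolOn_eq F (W := W) x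
  choose ext hext hext₀ using hext
  let U₂ := U ∩ U' ∩ U₁
  have hU₂ : IsOpen U₂ := (hs.isOpen.inter ht.isOpen).inter hU₁
  have hx₂ : x ∈ U₂ := ⟨⟨hx, hx'⟩, hx₁⟩
  have hs₂ : ∀ i, IsHolOn F (s i) U₂ := fun i => (hs.isHolOn i).mono fun y hy => hy.1.1
  have hu₂ : ∀ i, IsHolOn F (ext (u₀ i)) U₂ := fun i => (hext _).mono fun y hy => hy.2
  have hc := (P.contMDiffAt_det_pairMatrix hU₂ hs₂ hu₂ hx₂).continuousAt
  -- The remaining condition for being adapted is the nonvanishing of a continuous determinant,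
  -- which persists near `x`.
  have hne := hc.eventually_ne (by simpa only [hext₀] using hu₀.det_ne_zero)
  obtain ⟨U₃, hU₃, hU₃o, hx₃⟩ := eventually_nhds_iff.1 hne
  exact ⟨fun i => ext (u₀ i), U₂ ∩ U₃, hU₂.inter hU₃o, ⟨hx₂, hx₃⟩, fun y hy => hy.1.1.1,
    fun y hy => hy.1.1.2, fun i => (hu₂ i).mono inter_subset_left, fun y hy =>
    ⟨hs.linearIndependent y hy.1.1.1, hs.span_eq y hy.1.1.1, ht.linearIndependent y hy.1.1.2,
      ht.span_eq y hy.1.1.2, hU₃ y hy.2⟩⟩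

/-- There is a global function `g` such that `log det` of the Gram matrices of holomorphic frames
of `V^{⊥_Q}` and `V` differ by `g` and a pluriharmonic function. -/
theorem OrthogonalPair.exists_laplacian_log_gramDet_perp (V : Subbundle F W)
    (h : HermitianMetric F W) : ∃ g : X → ℝ, ContMDiff 𝓘(ℝ, ℂ) 𝓘(ℝ, ℝ) ∞ g ∧
      ∀ {r m : ℕ} {s : Fin r → ∀ x, W x} {t : Fin m → ∀ x, W x} {U U' : Set X},
        V.IsFrame s U → (P.perpBundle V).IsFrame t U' → ∀ x ∈ U, x ∈ U' → ∀ c : X,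
        x ∈ (chartAt ℂ c).source →
        laplacian ((fun x => Real.log (h.gramDet t x)) ∘ (chartAt ℂ c).symm) (chartAt ℂ c x)
          = laplacian ((fun x => Real.log (h.gramDet s x)) ∘ (chartAt ℂ c).symm) (chartAt ℂ c x)
            + laplacian (g ∘ (chartAt ℂ c).symm) (chartAt ℂ c x) := by
  -- The corrected ratio has the same value for all adapted bases of a fibre, so pointwise choices
  -- define a global `g` that is given by any local adapted frame.
  have hex : ∀ x, ∃ y : ℝ, ∀ {r m : ℕ} {s u : Fin r → W x} {t : Fin m → W x},
      IsAdapted (P.Q x) (V.fiber x) s t u → logRatio (P.Q x) (h.form x) s t u = y := by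
    intro x
    obtain ⟨U, hx, hU⟩ := V.exists_isFrame x
    obtain ⟨U', hx', hU'⟩ := (P.perpBundle V).exists_isFrame x
    obtain ⟨u, U'', -, hx'', -, -, -, hA⟩ := P.exists_isAdapted_nhds hU hU' hx hx'
    exact ⟨_, fun hA' => logRatio_eq_of_isAdapted (P.nondegenerate x) (h.conj_symm x) (h.pos x)
      (hA x hx'') hA'⟩
  choose g hg using hex
  have key : ∀ {r m : ℕ} {s : Fin r → ∀ x, W x} {t : Fin m → ∀ x, W x} {U U' : Set X},
      V.IsFrame s U → (P.perpBundle V).IsFrame t U' → ∀ x ∈ U, x ∈ U' →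
      ∃ f f' : X → ℂ, ContMDiffAt 𝓘(ℂ) 𝓘(ℂ) ω f x ∧ f x ≠ 0 ∧ ContMDiffAt 𝓘(ℂ) 𝓘(ℂ) ω f' x ∧
        f' x ≠ 0 ∧ ∀ᶠ y in 𝓝 x, g y = Real.log (h.gramDet t y) - Real.log (h.gramDet s y)
          + 2 * Real.log ‖f y‖ - Real.log ‖f' y‖ := by
    intro r m s t U U' hs ht x hx hx'
    obtain ⟨u, U'', hU'', hx'', h1, h2, hu, hA⟩ := P.exists_isAdapted_nhds hs ht hx hx'
    have hs' : ∀ i, IsHolOn F (s i) U'' := fun i => (hs.isHolOn i).mono h1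
    have ht' : ∀ i, IsHolOn F (t i) U'' := fun i => (ht.isHolOn i).mono h2
    let e : Fin m ⊕ Fin r → ∀ x, W x := Sum.elim t u
    have he : ∀ i, IsHolOn F (e i) U'' := by
      rintro (i | i)
      · exact ht' i
      · exact hu i
    have he' : ∀ y, (fun i => e i y) = Sum.elim (fun i => t i y) fun i => u i y := by
      intro y
      ext i
      rcases i with i | i <;> rfl
    refine ⟨_, _, P.contMDiffAt_det_pairMatrix hU'' hs' hu hx'', (hA x hx'').det_ne_zero,
      P.contMDiffAt_det_pairMatrix hU'' he he hx'', ?_, ?_⟩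
    · rw [he']
      exact (hA x hx'').det_elim_ne_zero (P.nondegenerate x)
    · filter_upwards [hU''.mem_nhds hx''] with y hy
      rw [← hg y (hA y hy), logRatio, he']
      rfl
  have hgs : ContMDiff 𝓘(ℝ, ℂ) 𝓘(ℝ, ℝ) ∞ g := by
    intro x
    obtain ⟨U, hx, hU⟩ := V.exists_isFrame x
    obtain ⟨U', hx', hU'⟩ := (P.perpBundle V).exists_isFrame x
    obtain ⟨f, f', hf, hf0, hf', hf0', heq⟩ := key hU hU' x hx hx'
    refine ContMDiffAt.congr_of_eventuallyEq ?_ heq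
    exact (((h.contMDiffAt_log_gramDet hU' hx').sub (h.contMDiffAt_log_gramDet hU hx)).add
      (contMDiffAt_const.mul (contMDiffAt_log_norm hf hf0))).sub (contMDiffAt_log_norm hf' hf0')
  refine ⟨g, hgs, ?_⟩
  intro r m s t U U' hs ht x hx hx' c hc
  obtain ⟨f, f', hf, hf0, hf', hf0', heq⟩ := key hs ht x hx hx'
  -- The identity is rearranged into sums and one multiple, so that additivity and homogeneity of
  -- the Laplacian apply; the two `log ‖·‖` terms are harmonic and drop out.
  have heq' : (fun x => Real.log (h.gramDet t x)) + (2 : ℝ) • (fun x => Real.log ‖f x‖)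
      =ᶠ[𝓝 x] (fun x => Real.log (h.gramDet s x)) + g + (fun x => Real.log ‖f' x‖) := by
    filter_upwards [heq] with y hy
    simp only [Pi.add_apply, Pi.smul_apply, smul_eq_mul, hy]
    ring
  have hlap := laplacian_chart_congr hc heq'
  have c1 := contMDiffAt_log_norm hf hf0
  have c2 := contMDiffAt_log_norm hf' hf0'
  have c3 := h.contMDiffAt_log_gramDet hs hx
  have c4 := h.contMDiffAt_log_gramDet ht hx'
  have c5 : ContMDiffAt 𝓘(ℝ, ℂ) 𝓘(ℝ, ℝ) ∞ ((2 : ℝ) • fun x => Real.log ‖f x‖) x :=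
    ContMDiffAt.mul (contMDiffAt_const (c := (2 : ℝ))) c1
  rw [laplacian_chart_add c4 c5 hc, laplacian_chart_smul _ c1 hc,
    laplacian_log_norm hf hf0 hc, laplacian_chart_add (c3.add hgs.contMDiffAt) c2 hc,
    laplacian_chart_add c3 hgs.contMDiffAt hc, laplacian_log_norm hf' hf0' hc] at hlap
  simpa using hlap

/-- The Chern density in a chart. -/
theorem Subbundle.chernDensity_eq (V : Subbundle F W) (h : HermitianMetric F W) (c x : X) :
    V.chernDensity h c x = -(1 / (4 * Real.pi)) *
      laplacian ((fun y => Real.log (h.gramDet (V.frame x) y)) ∘ (chartAt ℂ c).symm)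
        (chartAt ℂ c x) := rfl

/-- The Chern density is continuous, although it is defined with a frame chosen at each point. -/
theorem OrthogonalPair.continuousOn_chernDensity (P : OrthogonalPair F W L)
    (V : Subbundle F W) (h : HermitianMetric F W) (c : X) : ContinuousOn (fun z => V.chernDensity h c ((chartAt ℂ c).symm z))
      (chartAt ℂ c).target := by
  obtain ⟨g, hg, hlap⟩ := P.exists_laplacian_log_gramDet_perp V h
  intro z hz
  set x := (chartAt ℂ c).symm z
  have hxc : x ∈ (chartAt ℂ c).source := (chartAt ℂ c).map_target hz
  obtain ⟨U, hxU, hU⟩ := (P.perpBundle V).exists_isFrame x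
  let f : ℂ → ℝ := (fun y => Real.log (h.gramDet ((P.perpBundle V).frame x) y)) ∘
    (chartAt ℂ c).symm
  -- The frame in `V.chernDensity` varies with the point. Comparison with one fixed frame of `V^⊥`
  -- near `x` removes this dependence, as the defining relation of `g` holds for every frame of `V`.
  have heq : (fun z => V.chernDensity h c ((chartAt ℂ c).symm z)) =ᶠ[𝓝 z]
      fun w => -(1 / (4 * Real.pi)) * (laplacian f w - laplacian (g ∘ (chartAt ℂ c).symm) w) := by
    have h1 := (chartAt ℂ c).continuousAt_symm hz
    filter_upwards [h1.eventually (hU.isOpen.mem_nhds hxU),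
      (chartAt ℂ c).open_target.mem_nhds hz] with w hw hwt
    obtain ⟨U', hxU', hU'⟩ := V.exists_isFrame ((chartAt ℂ c).symm w)
    rw [V.chernDensity_eq]
    have := hlap hU' hU _ hxU' hw c ((chartAt ℂ c).map_target hwt)
    rw [(chartAt ℂ c).right_inv hwt] at this ⊢
    rw [this]
    ring
  refine ContinuousAt.continuousWithinAt (ContinuousAt.congr ?_ heq.symm)
  have h1 := contDiffAt_comp_chart_symm (h.contMDiffAt_log_gramDet hU hxU) hxc
  have h2 := contDiffAt_comp_chart_symm (c := c) hg.contMDiffAt hxc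
  rw [show chartAt ℂ c x = z from (chartAt ℂ c).right_inv hz] at h1 h2
  exact continuousAt_const.mul ((continuousAt_laplacian h1).sub (continuousAt_laplacian h2))

variable [T2Space X] [CompactSpace X]

/-- The two densities differ by `-(1 / 4π) Δg`, whose integral vanishes by Stokes. Continuity of the
densities gives the integrability needed to subtract the integrals. -/
theorem OrthogonalPair.chernIntegral_perpBundle (V : Subbundle F W) (h : HermitianMetric F W) :
    (P.perpBundle V).chernIntegral h = V.chernIntegral h := by
  obtain ⟨g, hg, hlap⟩ := P.exists_laplacian_log_gramDet_perp V h
  obtain ⟨a, ha, -⟩ := exists_finset_partitionOfUnity X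
  have hsum : ∀ f : X → ℂ → ℝ, ∑ᶠ c : X, ∫ z in (chartAt ℂ c).target,
      partitionOfUnity X c ((chartAt ℂ c).symm z) * f c z
      = ∑ c ∈ a, ∫ z in (chartAt ℂ c).target,
        partitionOfUnity X c ((chartAt ℂ c).symm z) * f c z := by
    intro f
    refine finsum_eq_sum_of_support_subset _ fun c hc => ?_
    by_contra hca
    exact hc (by simp [ha c hca])
  have h0 := finsum_integral_laplacian_eq_zero hg
  rw [Subbundle.chernIntegral, Subbundle.chernIntegral, hsum, hsum]
  rw [hsum] at h0
  rw [← sub_eq_zero, ← Finset.sum_sub_distrib, ← mul_zero (-(1 / (4 * Real.pi))), ← h0,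
    Finset.mul_sum]
  refine Finset.sum_congr rfl fun c _ => ?_
  rw [← integral_sub (integrableOn_partitionOfUnity_mul c (P.continuousOn_chernDensity _ h c))
    (integrableOn_partitionOfUnity_mul c (P.continuousOn_chernDensity _ h c)),
    ← integral_const_mul]
  refine setIntegral_congr_fun (chartAt ℂ c).open_target.measurableSet fun z hz => ?_
  obtain ⟨U, hx, hU⟩ := V.exists_isFrame ((chartAt ℂ c).symm z)
  obtain ⟨U', hx', hU'⟩ := (P.perpBundle V).exists_isFrame ((chartAt ℂ c).symm z)
  have := hlap hU hU' _ hx hx' c ((chartAt ℂ c).map_target hz)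
  rw [(chartAt ℂ c).right_inv hz] at this
  simp only [Subbundle.chernDensity_eq, (chartAt ℂ c).right_inv hz, this]
  ring

/-- `deg V^{⊥_Q} = deg V`. -/
theorem OrthogonalPair.degree_perpBundle (V : Subbundle F W) :
    (P.perpBundle V).degree = V.degree :=
  P.chernIntegral_perpBundle V _

/-- The zero subbundle has degree zero. -/
theorem Subbundle.degree_eq_zero {V : Subbundle F W} (hV : ∀ x, V.fiber x = ⊥) :
    V.degree = 0 := by
  have hd : ∀ (h : HermitianMetric F W) (c x : X), V.chernDensity h c x = 0 := by
    intro h c x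
    obtain ⟨U, hx, hU⟩ := V.exists_isFrame x
    have hr : (V.exists_frame x).choose = 0 := by
      rw [← Fintype.card_fin (V.exists_frame x).choose,
        ← finrank_span_eq_card (hU.linearIndependent x hx), hU.span_eq x hx, hV, finrank_bot]
    have hE : IsEmpty (Fin (V.exists_frame x).choose) := by rw [hr]; infer_instance
    -- The empty Gram determinant is `1`.
    have : (fun y => Real.log (h.gramDet (V.frame x) y)) = fun _ => 0 := by
      ext y
      simp [HermitianMetric.gramDet]
    rw [V.chernDensity_eq, this]
    have : ((fun _ => 0 : X → ℝ) ∘ (chartAt ℂ c).symm) = fun _ => (0 : ℝ) := rfl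
    rw [this]
    simp
  simp [Subbundle.degree, Subbundle.chernIntegral, hd]

end Degree
end HiggsPair
end

noncomputable section

namespace HiggsPair

set_option linter.unusedSectionVars false

/-! ### Filtrations, invariant subbundles and the stability criteria -/

section Criteria

variable {X : Type*} [TopologicalSpace X] [ChartedSpace ℂ X] [IsManifold 𝓘(ℂ) ω X]
  {F : Type*} [NormedAddCommGroup F] [NormedSpace ℂ F] [FiniteDimensional ℂ F]
  {W : X → Type*} [∀ x, AddCommGroup (W x)] [∀ x, Module ℂ (W x)] [∀ x, TopologicalSpace (W x)]
  [TopologicalSpace (TotalSpace F W)] [FiberBundle F W] [VectorBundle ℂ F W]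
  [ContMDiffVectorBundle ω F W 𝓘(ℂ)]
  {L : X → Type*} [∀ x, AddCommGroup (L x)] [∀ x, Module ℂ (L x)] [∀ x, TopologicalSpace (L x)]
  [TopologicalSpace (TotalSpace ℂ L)] [FiberBundle ℂ L] [VectorBundle ℂ ℂ L]

namespace OrthogonalPair

variable {P : OrthogonalPair F W L}

/-- The endomorphism of `W x` that corresponds to `ψ x`, after the choice of a generator of
`L x`. -/
def endo (P : OrthogonalPair F W L) (x : X) : W x →ₗ[ℂ] W x :=
  twistedContract (P.Q x) ((trivializationAt ℂ L x).linearEquivAt ℂ x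
    (mem_baseSet_trivializationAt ℂ L x)) (P.ψ x)

/-- The subbundle `V` is `ψ`-invariant. -/
def IsInvariant (P : OrthogonalPair F W L) (V : Subbundle F W) : Prop :=
  ∀ x, V.fiber x ∈ Module.End.invtSubmodule (P.endo x)

theorem isIsotropic_iff {V : Subbundle F W} :
    P.IsIsotropic V ↔ ∀ x, V.fiber x ≤ P.perp V x :=
  forall_congr' fun _ => ⟨fun h v hv w hw => h w hw v hv, fun h v hv _ hw => h hw v hv⟩

theorem compatible_iff {V : Subbundle F W} (hV : P.IsIsotropic V) :
    P.Compatible V ↔ P.IsInvariant V :=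
  forall_congr' fun x =>
    haveI := finiteDimensional_fiber F W x
    mem_compatible_iff (P.symm x) (P.nondegenerate x) _ _ (isIsotropic_iff.1 hV x)

theorem IsInvariant.perpBundle {V : Subbundle F W} (hV : P.IsInvariant V) :
    P.IsInvariant (P.perpBundle V) :=
  fun x => orthogonal_mem_invtSubmodule (P.symm x) (hV x)

theorem isIsotropic_bot : P.IsIsotropic (Subbundle.bot F W) := by
  intro x v hv w _
  rw [(Submodule.mem_bot ℂ).1 hv]
  simp

theorem isInvariant_bot : P.IsInvariant (Subbundle.bot F W) :=
  fun _ => Module.End.invtSubmodule.bot_mem _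

theorem isCompl_perp {x : X} {A B : Submodule ℂ (W x)} (h : IsCompl A B) :
    IsCompl ((P.Q x).orthogonal A) ((P.Q x).orthogonal B) := by
  have := finiteDimensional_fiber F W x
  refine IsCompl.of_eq ?_ ?_
  · rw [← orthogonal_sup_eq, h.sup_eq_top, orthogonal_eq_bot_of_top]
  · have hh := orthogonal_orthogonal (P.symm x) (P.nondegenerate x)
    rw [← hh (_ ⊔ _), orthogonal_sup_eq, hh, hh, h.inf_eq_bot, LinearMap.BilinForm.orthogonal_bot]

namespace IsFiltration

variable {k : ℕ} {V : ℕ → Subbundle F W}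

theorem mono (hV : P.IsFiltration k V) {i j : ℕ} (hij : i ≤ j) (hj : j ≤ k) (x : X) :
    (V i).fiber x ≤ (V j).fiber x := by
  induction j, hij using Nat.le_induction with
  | base => rfl
  | succ j _ ih => exact (ih (by omega)).trans (hV.le j (by omega) x)

theorem eq_perpBundle (hV : P.IsFiltration k V) {j : ℕ} (hj : j ≤ k) :
    V j = P.perpBundle (V (k - j)) :=
  Subbundle.ext fun x => hV.perp j hj x

theorem isIsotropic (hV : P.IsFiltration k V) {j : ℕ} (hj : 2 * j ≤ k) :
    P.IsIsotropic (V j) := by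
  refine isIsotropic_iff.2 fun x => ?_
  refine (hV.mono (show j ≤ k - j by omega) (Nat.sub_le k j) x).trans_eq ?_
  rw [hV.perp (k - j) (Nat.sub_le k j), Nat.sub_sub_self (by omega)]

theorem isInvariant (hV : P.IsFiltration k V) {lam : ℕ → ℝ} (hlam : IsWeight k lam)
    (hN : P.MemN k V lam) {j : ℕ} (h1 : 1 ≤ j) (hj : j < k) (hlt : lam j < lam (j + 1)) :
    P.IsInvariant (V j) :=
  fun x => mem_invtSubmodule_of_lt (V := fun i => (V i).fiber x)
    (fun _ _ hij hj => hV.mono hij hj x) (fun i hi => hV.perp i hi x) hlam (hN x) h1 hj hlt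

theorem ne_bot (hV : P.IsFiltration k V) {j : ℕ} (h1 : 1 ≤ j) (hj : j ≤ k) :
    (V j).fiber ≠ ⊥ := by
  intro h
  obtain ⟨x, hx⟩ := hV.ne 0 (by omega)
  refine hx ?_
  rw [hV.zero, eq_comm, eq_bot_iff]
  exact (hV.mono h1 hj x).trans_eq (congrFun h x)

theorem ne_top (hV : P.IsFiltration k V) {j : ℕ} (hj : j < k) : (V j).fiber ≠ ⊤ := by
  intro h
  obtain ⟨x, hx⟩ := hV.ne j hj
  have : (V j).fiber x = ⊤ := congrFun h x
  exact hx (this.trans (top_le_iff.1 (this ▸ hV.le j hj x)).symm)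

end IsFiltration

/-- A constant weight is its own negative, by the antisymmetry, and so is zero. -/
theorem exists_lt_of_ne_zero {k : ℕ} {lam : ℕ → ℝ} (hlam : IsWeight k lam)
    (h0 : ∃ i ∈ Finset.Icc 1 k, lam i ≠ 0) : ∃ j ∈ Finset.Ico 1 k, lam j < lam (j + 1) := by
  by_contra! h
  obtain ⟨i, hi, hne⟩ := h0
  rw [Finset.mem_Icc] at hi
  have hconst : ∀ j, 1 ≤ j → j ≤ k → lam j = lam 1 := by
    intro j h1 hj
    induction j, h1 using Nat.le_induction with
    | base => rfl
    | succ j h1 ih =>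
      have h2 := h j (Finset.mem_Ico.2 ⟨h1, by omega⟩)
      rw [le_antisymm h2 (hlam.mono j h1 (by omega)), ih (by omega)]
  have h2 := hlam.antisymm i hi.1 hi.2
  rw [hconst i hi.1 hi.2, hconst (k - i + 1) (by omega) (by omega)] at h2
  exact hne (by rw [hconst i hi.1 hi.2]; linarith)

/-- A flag opposite to a self-dual filtration by invariant subbundles. -/
theorem exists_opposite {k : ℕ} {V : ℕ → Subbundle F W} (hV : P.IsFiltration k V)
    (hinv : ∀ j, 1 ≤ j → j < k → P.IsInvariant (V j))
    (hC : ∀ j, 1 ≤ j → 2 * j ≤ k → ∃ C : Subbundle F W, P.IsIsotropic C ∧ P.IsInvariant C ∧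
      ∀ x, IsCompl (P.perp (V j) x) (C.fiber x)) :
    ∃ O : ℕ → Subbundle F W, (∀ j ≤ k, ∀ x, IsCompl ((V (k - j)).fiber x) ((O j).fiber x)) ∧
      (∀ j ≤ k, ∀ x, (O j).fiber x ≤ P.perp (O (k - j)) x) ∧
      (∀ j < k, ∀ x, (O j).fiber x ≤ (O (j + 1)).fiber x) ∧ ∀ j ≤ k, P.IsInvariant (O j) := by
  have hC' : ∀ j, 2 * j ≤ k → ∃ C : Subbundle F W, P.IsIsotropic C ∧ P.IsInvariant C ∧
      ∀ x, IsCompl ((V (k - j)).fiber x) (C.fiber x) := by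
    intro j hj
    rcases Nat.eq_zero_or_pos j with rfl | h1
    · refine ⟨Subbundle.bot F W, isIsotropic_bot, isInvariant_bot, fun x => ?_⟩
      rw [Nat.sub_zero, hV.top]
      exact isCompl_top_bot
    · obtain ⟨C, h2, h3, h4⟩ := hC j h1 hj
      refine ⟨C, h2, h3, fun x => ?_⟩
      have := hV.perp (k - j) (Nat.sub_le k j) x
      rw [Nat.sub_sub_self (by omega)] at this
      exact this ▸ h4 x
  obtain ⟨m, hm⟩ : ∃ m, m = k / 2 := ⟨_, rfl⟩
  -- The lower half of the flag is built downwards from the middle index `m`, each term inside the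
  -- one above it.
  have hE : ∀ d ≤ m, ∃ E : ℕ → Subbundle F W, ∀ j, m - d ≤ j → j ≤ m →
      P.IsIsotropic (E j) ∧ P.IsInvariant (E j) ∧
      (∀ x, IsCompl ((V (k - j)).fiber x) ((E j).fiber x)) ∧
      (j < m → ∀ x, (E j).fiber x ≤ (E (j + 1)).fiber x) := by
    intro d
    induction d with
    | zero =>
      intro _
      obtain ⟨C, h1, h2, h3⟩ := hC' m (by omega)
      refine ⟨fun _ => C, fun j hj hjm => ?_⟩
      obtain rfl : j = m := by omega
      exact ⟨h1, h2, h3, fun h => absurd h (lt_irrefl _)⟩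
    | succ d ih =>
      intro hd
      obtain ⟨E, hE⟩ := ih (by omega)
      obtain ⟨i, hi⟩ : ∃ i, m - d = i + 1 := ⟨m - d - 1, by omega⟩
      obtain ⟨e1, e2, e3, -⟩ := hE (i + 1) hi.le (by omega)
      obtain ⟨C, c1, c2, c3⟩ := hC' i (by omega)
      have hle : ∀ x, (V (k - (i + 1))).fiber x ≤ (V (k - i)).fiber x := fun x =>
        hV.mono (by omega) (by omega) x
      have hdisj : ∀ x, Disjoint (C.fiber x) ((V (k - (i + 1))).fiber x) := fun x =>
        (c3 x).disjoint.symm.mono_right (hle x)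
      -- The new term is the projection of `C` to `E (i + 1)` along `V (k - (i + 1))`. It is
      -- isotropic as part of `E (i + 1)`, invariant as built from invariant subbundles, and still
      -- complementary to `V (k - i)`, because `C` is changed only by vectors of `V (k - (i + 1)) ≤
      -- V (k - i)`.
      obtain ⟨E', hE'⟩ := exists_inf P (E (i + 1)) (C.sup _ hdisj) fun x => by
        rw [eq_top_iff, ← (e3 x).sup_eq_top, sup_comm]
        exact sup_le_sup_left le_sup_right _
      have hE'' : ∀ x, E'.fiber x
          = (E (i + 1)).fiber x ⊓ (C.fiber x ⊔ (V (k - (i + 1))).fiber x) := hE'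
      refine ⟨Function.update E i E', fun j hj hjm => ?_⟩
      rcases eq_or_ne j i with rfl | hji
      · rw [Function.update_self, Function.update_of_ne (by omega)]
        refine ⟨fun x v hv w hw => ?_, fun x => ?_, fun x => ?_, fun _ x => ?_⟩
        · rw [hE''] at hv hw
          exact e1 x v hv.1 w hw.1
        · rw [hE'']
          exact Module.End.invtSubmodule.inf_mem (e2 x) (Module.End.invtSubmodule.sup_mem (c2 x)
            (hinv _ (by omega) (by omega) x))
        · rw [hE'']
          refine IsCompl.of_eq (eq_bot_iff.2 ?_) (eq_top_iff.2 ?_)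
          · rintro v ⟨hv, hvE, hv'⟩
            obtain ⟨c, hc, w, hw, rfl⟩ := Submodule.mem_sup.1 hv'
            have hcV : c ∈ (V (k - j)).fiber x := by
              simpa using sub_mem hv (hle x hw)
            have hc0 := Submodule.disjoint_def.1 (c3 x).disjoint c hcV hc
            rw [hc0, zero_add] at hvE ⊢
            exact Submodule.disjoint_def.1 (e3 x).disjoint w hw hvE
          · rw [← (c3 x).sup_eq_top]
            refine sup_le le_sup_left fun c hc => ?_
            have hct : c ∈ (V (k - (j + 1))).fiber x ⊔ (E (j + 1)).fiber x :=
              (e3 x).sup_eq_top ▸ Submodule.mem_top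
            obtain ⟨w, hw, e, he, rfl⟩ := Submodule.mem_sup.1 hct
            refine Submodule.add_mem_sup (hle x hw) ⟨he, ?_⟩
            have := Submodule.add_mem_sup hc (neg_mem hw)
            rwa [add_neg_cancel_comm] at this
        · rw [hE'']
          exact inf_le_left
      · rw [Function.update_of_ne hji, Function.update_of_ne (by omega)]
        exact hE j (by omega) hjm
  obtain ⟨E, hE⟩ := hE m le_rfl
  have hE1 : ∀ j ≤ m, P.IsIsotropic (E j) := fun j hj => (hE j (by omega) hj).1
  have hE2 : ∀ j ≤ m, P.IsInvariant (E j) := fun j hj => (hE j (by omega) hj).2.1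
  have hE3 : ∀ j ≤ m, ∀ x, IsCompl ((V (k - j)).fiber x) ((E j).fiber x) := fun j hj =>
    (hE j (by omega) hj).2.2.1
  have hE4 : ∀ j < m, ∀ x, (E j).fiber x ≤ (E (j + 1)).fiber x := fun j hj =>
    (hE j (by omega) hj.le).2.2.2 hj
  -- Duality defines the upper half; complements pass to orthogonals because `V (k - j) = (V j)^⊥`.
  refine ⟨fun j => if j ≤ m then E j else P.perpBundle (E (k - j)), ?_, ?_, ?_, ?_⟩
  · intro j hj x
    simp only
    split_ifs with h
    · exact hE3 j h x
    · have := isCompl_perp (P := P) (hE3 (k - j) (by omega) x)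
      have h2 := hV.perp (k - j) (by omega) x
      rw [Nat.sub_sub_self hj] at this h2
      exact h2 ▸ this
  · intro j hj x
    simp only
    split_ifs with h h' h'
    · have hkj : k - j = j := by omega
      rw [hkj]
      exact isIsotropic_iff.1 (hE1 _ h) x
    · rw [perp_perpBundle, Nat.sub_sub_self hj]
    · exact le_rfl
    · omega
  · intro j hj x
    simp only
    split_ifs with h h' h'
    · exact hE4 j (by omega) x
    · obtain rfl : j = m := by omega
      -- At the middle, `k - (m + 1)` is `m` for odd `k` and `m - 1` for even `k`. In both cases
      -- isotropy gives `E m ≤ (E m)^⊥ ≤ (E (k - (m + 1)))^⊥`.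
      have h1 : k - (j + 1) = j ∨ k - (j + 1) + 1 = j := by omega
      have h2 : (E (k - (j + 1))).fiber x ≤ (E j).fiber x := by
        rcases h1 with h1 | h1
        · rw [h1]
        · have := hE4 (k - (j + 1)) (by omega) x
          rwa [h1] at this
      exact (isIsotropic_iff.1 (hE1 j h) x).trans (LinearMap.BilinForm.orthogonal_le h2)
    · omega
    · have := hE4 (k - (j + 1)) (by omega) x
      rw [show k - (j + 1) + 1 = k - j by omega] at this
      exact LinearMap.BilinForm.orthogonal_le this
  · intro j hj
    simp only
    split_ifs with h
    · exact hE2 j h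
    · exact (hE2 (k - j) (by omega)).perpBundle

/-- An opposite invariant flag splits the filtration. -/
theorem exists_isSplitting {k : ℕ} {V : ℕ → Subbundle F W} (hV : P.IsFiltration k V)
    {lam : ℕ → ℝ} (hlam : IsWeight k lam) (hinv : ∀ j, 1 ≤ j → j < k → P.IsInvariant (V j))
    {O : ℕ → Subbundle F W}
    (hO1 : ∀ j ≤ k, ∀ x, IsCompl ((V (k - j)).fiber x) ((O j).fiber x))
    (hO2 : ∀ j ≤ k, ∀ x, (O j).fiber x ≤ P.perp (O (k - j)) x)
    (hO3 : ∀ j < k, ∀ x, (O j).fiber x ≤ (O (j + 1)).fiber x)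
    (hO4 : ∀ j ≤ k, P.IsInvariant (O j)) : ∃ U, P.IsSplitting k V lam U := by
  have hOmono : ∀ i j, i ≤ j → j ≤ k → ∀ x, (O i).fiber x ≤ (O j).fiber x := by
    intro i j hij hj x
    induction j, hij using Nat.le_induction with
    | base => rfl
    | succ j _ ih => exact (ih (by omega)).trans (hO3 j (by omega) x)
  have hU : ∀ i, ∃ U : Subbundle F W, i ∈ Finset.Icc 1 k →
      ∀ x, U.fiber x = (V i).fiber x ⊓ (O (k + 1 - i)).fiber x := by
    intro i
    by_cases hi : i ∈ Finset.Icc 1 k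
    · have hi' := Finset.mem_Icc.1 hi
      -- `V i` and `O (k + 1 - i)` span `W`, since already `V i ⊕ O (k - i) = W`.
      obtain ⟨U, hU⟩ := exists_inf P (V i) (O (k + 1 - i)) fun x => by
        rw [eq_top_iff, ← (hO1 (k - i) (Nat.sub_le k i) x).sup_eq_top, Nat.sub_sub_self hi'.2]
        exact sup_le_sup_left (hOmono _ _ (by omega) (by omega) x) _
      exact ⟨U, fun _ => hU⟩
    · exact ⟨V i, fun h => absurd h hi⟩
  choose U hU using hU
  have hcompl : ∀ i < k, ∀ x, IsCompl ((V i).fiber x) ((O (k - i)).fiber x) := by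
    intro i hi x
    have := hO1 (k - i) (Nat.sub_le k i) x
    rwa [Nat.sub_sub_self hi.le] at this
  have hU' : ∀ i < k, ∀ x, (U (i + 1)).fiber x = (V (i + 1)).fiber x ⊓ (O (k - i)).fiber x := by
    intro i hi x
    rw [hU (i + 1) (Finset.mem_Icc.2 (by omega)) x, Nat.add_sub_add_right]
  have hsup : ∀ i < k, ∀ x,
      (V i).fiber x ⊔ (U (i + 1)).fiber x = (V (i + 1)).fiber x := by
    intro i hi x
    -- The modular law, with `V i ≤ V (i + 1)` and `V i ⊔ O (k - i) = W`.
    rw [hU' i hi, inf_comm, ← sup_inf_assoc_of_le _ (hV.le i hi x), (hcompl i hi x).sup_eq_top,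
      top_inf_eq]
  have horth : ∀ i ∈ Finset.Icc 1 k, ∀ j ∈ Finset.Icc 1 k, i + j ≠ k + 1 →
      ∀ x, ∀ v ∈ (U i).fiber x, ∀ w ∈ (U j).fiber x, P.Q x v w = 0 := by
    intro i hi j hj hij x v hv w hw
    rw [hU i hi] at hv
    rw [hU j hj] at hw
    rw [Finset.mem_Icc] at hi hj
    -- For `i + j ≤ k` the filtration gives `V i ≤ V (k - j) = (V j)^⊥`; for `i + j ≥ k + 2` the
    -- opposite flag gives `O (k + 1 - i) ≤ O (j - 1)`, which is orthogonal to `O (k + 1 - j)`.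
    rcases lt_or_gt_of_ne hij with h | h
    · have h1 := hV.mono (show i ≤ k - j by omega) (Nat.sub_le k j) x hv.1
      rw [hV.perp (k - j) (Nat.sub_le k j), Nat.sub_sub_self hj.2] at h1
      rw [P.symm]
      exact h1 w hw.1
    · have h1 := hOmono (k + 1 - i) (k - (k + 1 - j)) (by omega) (by omega) x hv.2
      have h2 := hO2 (k + 1 - j) (by omega) x hw.2
      exact h2 v h1
  refine ⟨U, fun i hi x => ?_, hsup, horth, fun x => ?_⟩
  · rw [hU' i hi]
    exact (hcompl i hi x).disjoint.mono_right inf_le_right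
  · have := finiteDimensional_fiber F W x
    have htop : ⨆ i : Finset.Icc 1 k, (U i).fiber x = ⊤ := by
      have hle : ∀ i ≤ k, (V i).fiber x ≤ ⨆ i : Finset.Icc 1 k, (U i).fiber x := by
        intro i
        induction i with
        | zero => intro _; rw [hV.zero]; exact bot_le
        | succ i ih =>
          intro hi
          rw [← hsup i (by omega) x]
          exact sup_le (ih (by omega)) (le_iSup (fun i : Finset.Icc 1 k => (U i).fiber x)
            ⟨i + 1, Finset.mem_Icc.2 (by omega)⟩)
      rw [eq_top_iff, ← hV.top x]
      exact hle k le_rfl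
    have hVinv : ∀ i ∈ Finset.Icc 1 k, P.IsInvariant (V i) := by
      intro i hi
      rw [Finset.mem_Icc] at hi
      rcases hi.2.eq_or_lt with rfl | h
      · intro x
        rw [hV.top]
        exact Module.End.invtSubmodule.top_mem _
      · exact hinv i hi.1 h
    have hmem := mem_iSup_of_splitting (P.symm x) (P.nondegenerate x)
      ((trivializationAt ℂ L x).linearEquivAt ℂ x (mem_baseSet_trivializationAt ℂ L x))
      (ψ := P.ψ x) (U := fun i => (U i).fiber x) htop (fun i hi j hj hij => horth i hi j hj hij x)
      fun i hi => by
        rw [hU i hi]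
        exact Module.End.invtSubmodule.inf_mem (hVinv i hi x)
          (hO4 _ (by rw [Finset.mem_Icc] at hi; omega) x)
    refine SetLike.le_def.1 (iSup_le fun i => ?_) hmem
    have hi := Finset.mem_Icc.1 i.2
    refine le_iSup₂_of_le (k + 1 - i) (Finset.mem_Icc.2 (by omega)) (le_iSup₂_of_le (i : ℕ) i.2
      (le_iSup_of_le ?_ le_rfl))
    rw [add_comm, show k + 1 - (i : ℕ) = k - i + 1 by omega]
    exact hlam.antisymm i hi.1 hi.2

/-- The last summand of a splitting is a complement as required in the criterion. -/
theorem IsSplitting.last {k : ℕ} {V : ℕ → Subbundle F W} {lam : ℕ → ℝ} (hk : 2 ≤ k)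
    (hV : P.IsFiltration k V) (hlam : IsWeight k lam)
    (hlt : ∀ i, 1 ≤ i → i < k → lam i < lam (i + 1)) {U : ℕ → Subbundle F W}
    (hU : P.IsSplitting k V lam U) : P.IsIsotropic (U k) ∧ P.Compatible (U k) ∧
      ∀ x, IsCompl ((V (k - 1)).fiber x) ((U k).fiber x) := by
  have hkk : k ∈ Finset.Icc 1 k := Finset.mem_Icc.2 (by omega)
  have hstrict : ∀ i j, 1 ≤ i → i < j → j ≤ k → lam i < lam j := fun i j hi hij hj =>
    (hlt i hi (by omega)).trans_le (IsWeight.le hlam (by omega) hij hj)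
  refine ⟨fun x => hU.orthogonal k hkk k hkk (by omega) x, fun x => ?_, fun x => ?_⟩
  · refine SetLike.le_def.1 (iSup₂_le fun i hi => iSup₂_le fun j hj => iSup_le fun hij => ?_)
      (hU.mem x)
    have hi' := Finset.mem_Icc.1 hi
    have hj' := Finset.mem_Icc.1 hj
    -- Strict monotonicity turns `lam i + lam j = 0` into `i + j = k + 1`. So either one index is
    -- `k`, or neither is `1` and both factors lie in `(U k)^⊥`.
    have hsum : i + j = k + 1 := by
      have h1 := hlam.antisymm i hi'.1 hi'.2
      rcases lt_trichotomy j (k - i + 1) with h | h | h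
      · have := hstrict j _ hj'.1 h (by omega)
        linarith
      · omega
      · have := hstrict _ j (by omega) h hj'.2
        linarith
    have hperp : ∀ a ∈ Finset.Icc 1 k, a ≠ 1 → (U a).fiber x ≤ P.perp (U k) x :=
      fun a ha ha1 v hv w hw => hU.orthogonal k hkk a ha (by omega) x w hw v hv
    rcases eq_or_ne i k with rfl | hik
    · exact le_sup_of_le_right (twistedSymProd_mono le_rfl le_top)
    rcases eq_or_ne j k with rfl | hjk
    · rw [twistedSymProd_comm]
      exact le_sup_of_le_right (twistedSymProd_mono le_rfl le_top)
    · exact le_sup_of_le_left (twistedSymProd_mono (hperp i hi (by omega))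
        (hperp j hj (by omega)))
  · have h1 := hU.disjoint (k - 1) (by omega) x
    have h2 := hU.sup_eq (k - 1) (by omega) x
    rw [Nat.sub_add_cancel (by omega)] at h1 h2
    rw [hV.top] at h2
    exact IsCompl.of_eq h1.eq_bot h2

/-! ### Weighted degrees and the stability criteria -/

variable [T2Space X] [CompactSpace X]

/-- Where `lam` jumps, the filtration gives an admissible subbundle. -/
theorem IsFiltration.exists_admissible {k : ℕ} {V : ℕ → Subbundle F W} {lam : ℕ → ℝ}
    (hV : P.IsFiltration k V) (hlam : IsWeight k lam) (hN : P.MemN k V lam) {j : ℕ}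
    (h1 : 1 ≤ j) (hj : j < k) (hlt : lam j < lam (j + 1)) :
    ∃ W' : Subbundle F W, P.IsIsotropic W' ∧ W'.fiber ≠ ⊥ ∧ W'.fiber ≠ ⊤ ∧ P.Compatible W' ∧
      W'.degree = (V j).degree := by
  have key : ∀ i, 1 ≤ i → 2 * i ≤ k → lam i < lam (i + 1) → (V i).degree = (V j).degree →
      ∃ W' : Subbundle F W, P.IsIsotropic W' ∧ W'.fiber ≠ ⊥ ∧ W'.fiber ≠ ⊤ ∧ P.Compatible W' ∧
      W'.degree = (V j).degree := fun i hi hik hilt hdeg =>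
    ⟨V i, hV.isIsotropic hik, hV.ne_bot hi (by omega), hV.ne_top (by omega),
      (compatible_iff (hV.isIsotropic hik)).2 (hV.isInvariant hlam hN hi (by omega) hilt), hdeg⟩
  rcases le_or_gt (2 * j) k with h | h
  · exact key j h1 h hlt rfl
  -- In the upper half `V j` is replaced by its isotropic orthogonal `V (k - j)`; by antisymmetry
  -- `lam` jumps there too.
  · refine key (k - j) (by omega) (by omega) ?_ ?_
    · have e1 := hlam.antisymm j h1 hj.le
      have e2 := hlam.antisymm (j + 1) (by omega) (by omega)
      rw [show k - (j + 1) + 1 = k - j by omega] at e2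
      linarith
    · rw [hV.eq_perpBundle hj.le, degree_perpBundle]

/-- The filtration `0 ⊊ W' ⊆ W'^⊥ ⊊ W` of an admissible subbundle. -/
theorem exists_isFiltration {W' : Subbundle F W} (hiso : P.IsIsotropic W')
    (hcomp : P.Compatible W') (hne : W'.fiber ≠ ⊥) :
    ∃ (k : ℕ) (V : ℕ → Subbundle F W) (lam : ℕ → ℝ), 2 ≤ k ∧ P.IsFiltration k V ∧
      IsWeight k lam ∧ (∀ i, 1 ≤ i → i < k → lam i < lam (i + 1)) ∧
      (∃ i ∈ Finset.Icc 1 k, lam i ≠ 0) ∧ P.MemN k V lam ∧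
      weightedDegree k V lam = -2 * W'.degree ∧ ∀ x, (V (k - 1)).fiber x = P.perp W' x := by
  have hle := isIsotropic_iff.1 hiso
  obtain ⟨x₀, hx₀⟩ := Function.ne_iff.1 hne
  have hx₀' : W'.fiber x₀ ≠ ⊥ := hx₀
  have htop : ∀ x, (P.perpBundle (Subbundle.bot F W)).fiber x = ⊤ := fun x =>
    LinearMap.BilinForm.orthogonal_bot
  have hbot : ∀ x, (Subbundle.bot F W).fiber x = ⊥ := fun x => rfl
  have hpp : ∀ x, P.perp (P.perpBundle W') x = W'.fiber x := P.perp_perpBundle W'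
  have hptop : ∀ x, P.perp (P.perpBundle (Subbundle.bot F W)) x = ⊥ :=
    P.perp_perpBundle (Subbundle.bot F W)
  have hperp_ne : P.perp W' x₀ ≠ ⊤ := fun h => by
    have := hpp x₀
    rw [perp, perpBundle_fiber, h, orthogonal_eq_bot_of_top] at this
    exact hx₀' this.symm
  -- The steps of a filtration must be distinct, so a Lagrangian `W'` needs the shorter filtration
  -- with weights `-1, 1`.
  by_cases heq : ∀ x, P.perp W' x = W'.fiber x
  · let V : ℕ → Subbundle F W
      | 0 => Subbundle.bot F W
      | 1 => W'
      | _ => P.perpBundle (Subbundle.bot F W)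
    let lam : ℕ → ℝ
      | 1 => -1
      | _ => 1
    refine ⟨2, V, lam, le_rfl, ⟨hbot, htop, ?_, ?_, ?_⟩, ⟨?_, ?_⟩, ?_, ⟨1, by simp, ?_⟩, ?_, ?_,
      fun x => (heq x).symm⟩
    · intro j hj x
      interval_cases j
      · exact bot_le
      · exact le_top.trans_eq (htop x).symm
    · intro j hj
      refine ⟨x₀, ?_⟩
      interval_cases j
      · exact hx₀'.symm
      · refine fun h => hperp_ne ?_
        rw [heq]
        exact h.trans (htop x₀)
    · intro j hj x
      interval_cases j
      · exact (hptop x).symm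
      · exact (heq x).symm
      · rfl
    · intro i h1 hi
      interval_cases i
      norm_num [lam]
    · intro i h1 hi
      interval_cases i <;> norm_num [lam]
    · intro i h1 hi
      interval_cases i
      norm_num [lam]
    · norm_num [lam]
    · intro x
      refine SetLike.le_def.1 (sup_le ?_ ?_) (hcomp x)
      · rw [heq]
        exact le_iSup₂_of_le 1 (by simp) (le_iSup₂_of_le 1 (by simp)
          (le_iSup_of_le (by norm_num [lam]) le_rfl))
      · exact le_iSup₂_of_le 1 (by simp) (le_iSup₂_of_le 2 (by simp)
          (le_iSup_of_le (by norm_num [lam]) (twistedSymProd_mono le_rfl (htop x).ge)))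
    · simp only [weightedDegree, show Finset.Ico 1 2 = {1} from rfl, Finset.sum_singleton, lam, V]
      norm_num
  · push Not at heq
    obtain ⟨x₁, hx₁⟩ := heq
    let V : ℕ → Subbundle F W
      | 0 => Subbundle.bot F W
      | 1 => W'
      | 2 => P.perpBundle W'
      | _ => P.perpBundle (Subbundle.bot F W)
    let lam : ℕ → ℝ
      | 1 => -1
      | 2 => 0
      | _ => 1
    refine ⟨3, V, lam, by norm_num, ⟨hbot, htop, ?_, ?_, ?_⟩, ⟨?_, ?_⟩, ?_, ⟨1, by simp, ?_⟩, ?_,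
      ?_, fun x => rfl⟩
    · intro j hj x
      interval_cases j
      · exact bot_le
      · exact hle x
      · exact le_top.trans_eq (htop x).symm
    · intro j hj
      interval_cases j
      · exact ⟨x₀, hx₀'.symm⟩
      · exact ⟨x₁, hx₁.symm⟩
      · exact ⟨x₀, fun h => hperp_ne (h.trans (htop x₀))⟩
    · intro j hj x
      interval_cases j
      · exact (hptop x).symm
      · exact (hpp x).symm
      · rfl
      · rfl
    · intro i h1 hi
      interval_cases i <;> norm_num [lam]
    · intro i h1 hi
      interval_cases i <;> norm_num [lam]
    · intro i h1 hi
      interval_cases i <;> norm_num [lam]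
    · norm_num [lam]
    · intro x
      refine SetLike.le_def.1 (sup_le ?_ ?_) (hcomp x)
      -- The part `S² W'^⊥` uses the weight pair `0 + 0`, the part `W' ⊗_S W` the pair `-1 + 1`.
      · exact le_iSup₂_of_le 2 (by simp) (le_iSup₂_of_le 2 (by simp)
          (le_iSup_of_le (by norm_num [lam]) le_rfl))
      · exact le_iSup₂_of_le 1 (by simp) (le_iSup₂_of_le 3 (by simp)
          (le_iSup_of_le (by norm_num [lam]) (twistedSymProd_mono le_rfl (htop x).ge)))
    · simp only [weightedDegree, show Finset.Ico 1 3 = {1, 2} from rfl, Finset.mem_singleton,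
        OfNat.one_ne_ofNat, not_false_eq_true, Finset.sum_insert, Finset.sum_singleton, lam, V,
        degree_perpBundle]
      ring

theorem semistable_iff : P.Semistable ↔
    ∀ W' : Subbundle F W, P.IsIsotropic W' → P.Compatible W' → W'.degree ≤ 0 := by
  constructor
  · intro h W' hiso hcomp
    by_cases hne : W'.fiber = ⊥
    · exact (Subbundle.degree_eq_zero fun x => congrFun hne x).le
    · obtain ⟨k, V, lam, -, hV, hlam, -, -, hN, hd, -⟩ := exists_isFiltration hiso hcomp hne
      have := h k V lam hV hlam hN
      linarith
  · intro h k V lam hV hlam hN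
    refine Finset.sum_nonneg fun j hj => ?_
    rw [Finset.mem_Ico] at hj
    rcases (hlam.mono j hj.1 hj.2).eq_or_lt with heq | hlt
    · rw [heq, sub_self, zero_mul]
    · obtain ⟨W', h1, -, -, h2, h3⟩ := hV.exists_admissible hlam hN hj.1 hj.2 hlt
      exact mul_nonneg_of_nonpos_of_nonpos (by linarith) (h3 ▸ h W' h1 h2)

theorem stable_iff : P.Stable ↔ P.Semistable ∧
    ∀ W' : Subbundle F W, P.IsIsotropic W' → W'.fiber ≠ ⊥ → W'.fiber ≠ ⊤ → P.Compatible W' →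
      W'.degree < 0 := by
  refine and_congr_right fun hss => ⟨fun h W' hiso hne _ hcomp => ?_, fun h => ?_⟩
  · obtain ⟨k, V, lam, -, hV, hlam, -, h0, hN, hd, -⟩ := exists_isFiltration hiso hcomp hne
    have := h k V lam hV hlam h0 hN
    linarith
  · intro k V lam hV hlam h0 hN
    obtain ⟨j, hj, hlt⟩ := exists_lt_of_ne_zero hlam h0
    have hpos : ∀ i ∈ Finset.Ico 1 k, lam i < lam (i + 1) →
        0 < (lam i - lam (i + 1)) * (V i).degree := by
      intro i hi hlt
      rw [Finset.mem_Ico] at hi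
      obtain ⟨W', h1, h2, h3, h4, h5⟩ := hV.exists_admissible hlam hN hi.1 hi.2 hlt
      exact mul_pos_of_neg_of_neg (by linarith) (h5 ▸ h W' h1 h2 h3 h4)
    refine Finset.sum_pos' (fun i hi => ?_) ⟨j, hj, hpos j hj hlt⟩
    have hi' := Finset.mem_Ico.1 hi
    rcases (hlam.mono i hi'.1 hi'.2).eq_or_lt with heq | hlt
    · rw [heq, sub_self, zero_mul]
    · exact (hpos i hi hlt).le

/-- Polystability is applied to the short filtration of `W'`, whose last proper step is `W'^⊥`. In
the other direction the complements for the isotropic steps are assembled into an opposite flag. -/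
theorem polystable_iff : P.Polystable ↔ P.Semistable ∧
    ∀ W' : Subbundle F W, P.IsIsotropic W' → W'.fiber ≠ ⊥ → W'.fiber ≠ ⊤ → P.Compatible W' →
      W'.degree = 0 → ∃ W'' : Subbundle F W, P.IsIsotropic W'' ∧ P.Compatible W'' ∧
        ∀ x, IsCompl (P.perp W' x) (W''.fiber x) := by
  refine and_congr_right fun hss => ⟨fun h W' hiso hne _ hcomp hdeg => ?_, fun h => ?_⟩
  · obtain ⟨k, V, lam, hk, hV, hlam, hlt, -, hN, hd, hp⟩ := exists_isFiltration hiso hcomp hne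
    obtain ⟨U, hU⟩ := h k V lam hV hlam hlt hN (by rw [hd, hdeg, mul_zero])
    obtain ⟨h1, h2, h3⟩ := hU.last hk hV hlam hlt
    exact ⟨U k, h1, h2, fun x => hp x ▸ h3 x⟩
  · intro k V lam hV hlam hlt hN hd
    have hinv : ∀ j, 1 ≤ j → j < k → P.IsInvariant (V j) := fun j h1 hj =>
      hV.isInvariant hlam hN h1 hj (hlt j h1 hj)
    have hdeg : ∀ j ∈ Finset.Ico 1 k, (V j).degree = 0 := by
      intro j hj
      have hnonneg : ∀ i ∈ Finset.Ico 1 k, 0 ≤ (lam i - lam (i + 1)) * (V i).degree := by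
        intro i hi
        rw [Finset.mem_Ico] at hi
        obtain ⟨W', h1, -, -, h2, h3⟩ :=
          hV.exists_admissible hlam hN hi.1 hi.2 (hlt i hi.1 hi.2)
        exact mul_nonneg_of_nonpos_of_nonpos (by linarith [hlt i hi.1 hi.2])
          (h3 ▸ semistable_iff.1 hss W' h1 h2)
      -- Semistability makes all terms nonnegative, so a vanishing sum forces each degree to vanish.
      have h0 := (Finset.sum_eq_zero_iff_of_nonneg hnonneg).1 hd j hj
      rw [Finset.mem_Ico] at hj
      exact (mul_eq_zero.1 h0).resolve_left (sub_neg.2 (hlt j hj.1 hj.2)).ne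
    obtain ⟨O, h1, h2, h3, h4⟩ := exists_opposite hV hinv fun j h1 hj => by
      have hiso := hV.isIsotropic hj
      obtain ⟨C, c1, c2, c3⟩ := h (V j) hiso (hV.ne_bot h1 (by omega)) (hV.ne_top (by omega))
        ((compatible_iff hiso).2 (hinv j h1 (by omega)))
        (hdeg j (Finset.mem_Ico.2 ⟨h1, by omega⟩))
      exact ⟨C, c1, (compatible_iff c1).1 c2, c3⟩
    exact exists_isSplitting hV hlam hinv h1 h2 h3 h4

/-- If `W = W' ⊕ W''` with `W'`, `W''` isotropic, then `W'^{⊥_Q} = W'`. -/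
theorem perp_eq_of_isCompl {W' W'' : Subbundle F W} (h' : P.IsIsotropic W')
    (h'' : P.IsIsotropic W'') {x : X} (hc : IsCompl (W'.fiber x) (W''.fiber x)) :
    P.perp W' x = W'.fiber x := by
  refine le_antisymm (fun v hv => ?_) (isIsotropic_iff.1 h' x)
  have hvt : v ∈ W'.fiber x ⊔ W''.fiber x := hc.sup_eq_top ▸ Submodule.mem_top
  obtain ⟨a, ha, b, hb, rfl⟩ := Submodule.mem_sup.1 hvt
  -- `b` is orthogonal to `W'`, because `a + b` and `a` are, and to `W''` by isotropy.
  have hb0 : b = 0 := by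
    refine (P.nondegenerate x).1 b fun w => ?_
    have hwt : w ∈ W'.fiber x ⊔ W''.fiber x := hc.sup_eq_top ▸ Submodule.mem_top
    obtain ⟨c, hc, d, hd, rfl⟩ := Submodule.mem_sup.1 hwt
    have h1 := hv c hc
    rw [LinearMap.map_add, h' x c hc a ha, zero_add, P.symm] at h1
    rw [map_add, h1, h'' x b hb d hd, add_zero]
  rw [hb0, add_zero]
  exact ha

end OrthogonalPair

end Criteria

end HiggsPair

end

theorem mainTheorem10
    {X : Type*} [TopologicalSpace X] [T2Space X] [CompactSpace X] [ConnectedSpace X]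
    [ChartedSpace ℂ X] [IsManifold 𝓘(ℂ) ω X]
    {F : Type*} [NormedAddCommGroup F] [NormedSpace ℂ F] [FiniteDimensional ℂ F]
    {W : X → Type*} [∀ x, AddCommGroup (W x)] [∀ x, Module ℂ (W x)] [∀ x, TopologicalSpace (W x)]
    [TopologicalSpace (TotalSpace F W)] [FiberBundle F W] [VectorBundle ℂ F W]
    [ContMDiffVectorBundle ω F W 𝓘(ℂ)]
    {L : X → Type*} [∀ x, AddCommGroup (L x)] [∀ x, Module ℂ (L x)] [∀ x, TopologicalSpace (L x)]
    [TopologicalSpace (TotalSpace ℂ L)] [FiberBundle ℂ L] [VectorBundle ℂ ℂ L]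
    [ContMDiffVectorBundle ω ℂ L 𝓘(ℂ)]
    (P : HiggsPair.OrthogonalPair F W L) :
    -- semistability
    (P.Semistable ↔
      ∀ W' : HiggsPair.Subbundle F W, P.IsIsotropic W' → P.Compatible W' → W'.degree ≤ 0) ∧
    -- stability
    (P.Stable ↔ P.Semistable ∧
      ∀ W' : HiggsPair.Subbundle F W, P.IsIsotropic W' → W'.fiber ≠ ⊥ → W'.fiber ≠ ⊤ → P.Compatible W' →
        W'.degree < 0) ∧
    -- polystability: the criterion with `W = W' ⊕ W''` is sufficient
    ((P.Semistable ∧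
      ∀ W' : HiggsPair.Subbundle F W, P.IsIsotropic W' → W'.fiber ≠ ⊥ → W'.fiber ≠ ⊤ → P.Compatible W' →
        W'.degree = 0 →
        ∃ W'' : HiggsPair.Subbundle F W, P.IsIsotropic W'' ∧ P.Compatible W'' ∧
          ∀ x, IsCompl (W'.fiber x) (W''.fiber x)) → P.Polystable) ∧
    -- polystability: the criterion with `W = W'^⊥ ⊕ W''` is necessary and sufficient
    (P.Polystable ↔ P.Semistable ∧
      ∀ W' : HiggsPair.Subbundle F W, P.IsIsotropic W' → W'.fiber ≠ ⊥ → W'.fiber ≠ ⊤ → P.Compatible W' →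
        W'.degree = 0 →
        ∃ W'' : HiggsPair.Subbundle F W, P.IsIsotropic W'' ∧ P.Compatible W'' ∧
          ∀ x, IsCompl (P.perp W' x) (W''.fiber x)) :=
  ⟨HiggsPair.OrthogonalPair.semistable_iff, HiggsPair.OrthogonalPair.stable_iff,
    fun ⟨hss, h⟩ => HiggsPair.OrthogonalPair.polystable_iff.2 ⟨hss, fun W' h1 h2 h3 h4 h5 => by
      obtain ⟨W'', a, b, c⟩ := h W' h1 h2 h3 h4 h5
      exact ⟨W'', a, b, fun x => by
        rw [HiggsPair.OrthogonalPair.perp_eq_of_isCompl h1 a (c x)]; exact c x⟩⟩,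
    HiggsPair.OrthogonalPair.polystable_iff⟩
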